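/- Let $(X,\mu)$ be a measure space, $H$ a complex Hilbert space, and $A$ a (possibly unbounded) positive self-adjoint operator on $L^2(X,H)$. **Notation.** Let $\tau$ be the trace, with values in $[0,\infty]$ on positive operators, and $\chi_\Omega$ the multiplication by the indicator function of $\Omega$. For a bounded positive operator $P$ on $L^2(X,H)$ and a measurable $\Omega\subset X$ put $\nu_P(\Omega)=\tau(\chi_\Omega P\chi_\Omega)$, and let $D(P)=\sup_\Omega \nu_P(\Omega)/\mu(\Omega)\in[0,\infty]$ (supremum over measurable $\Omega$ with $0<\mu(\Omega)<\infty$) be the density of $P$. Let $\Pi_\lambda=\chi_A(]0,\lambda])$ be the spectral projections of $A$ and $F(\lambda)=D(\Pi_\lambda)$ for $\lambda\ge 0$. Let $\mathcal E(f)=\|A^{1/2}f\|_2^2\in[0,\infty]$ (equal to $\infty$ if $f\notin\operatorname{dom}A^{1/2}$). For a bounded positive operator $\rho$ let $\mathcal E(\rho)=\tau(\rho^{1/2}A\rho^{1/2})=\sum_i\mathcal E(\rho^{1/2}e_i)\in[0,\infty]$ for any Hilbert basis $(e_i)$, let $\|\rho^{1/2}A\rho^{1/2}\|_{2,2}=\sup_{\|f\|_2\le1}\mathcal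 E(\rho^{1/2}f)\in[0,\infty]$, and let $\langle A\rangle_\rho=\mathcal E(\rho)/\tau(\rho)$ (with $0/0=0$). **Assumptions.** Suppose that $F(\lambda)<\infty$ for all $\lambda\ge0$ and that the Stieltjes integral $$G(\lambda)=\int_{[0,\lambda]}\frac{dF(u)}{u}$$ is finite for all $0\le\lambda<\infty$ (a jump of $F$ at $0$ makes it infinite, and the mass of $dF$ at the end point $\lambda$ is $F(\lambda)-F(\lambda^-)$); put $G(\infty)=\sup_{\lambda<\infty}G(\lambda)$. Let $\Omega\subset X$ be measurable with $\mu(\Omega)<\infty$. **Conclusions.** (In $[0,\infty]$, with $0\cdot\infty=0$.) 1. Let $\rho$ be a bounded positive operator on $L^2(X,H)$ which vanishes on $\ker A$, is supported in $\Omega$ (every $\rho f$ vanishes almost everywhere outside $\Omega$), and for which $\tau(\rho)$ and $\mathcal E(\rho)$ are not both infinite. Then $$\tau(\rho)\le 8\,\mu(\Omega)\,\|\rho^{1/2}A\rho^{1/2}\|_{2,2}\;G\bigl(8\langle A\rangle_\rho\bigr).$$ 2. Let $F_\Omega^{\dim}(\lambda)$ be the supremum of $\dim V$ over all linear subspaces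 $V\subset L^2(X,H)\cap(\ker A)^\perp$ which consist of functions vanishing almost everywhere outside $\Omega$ and satisfy $\mathcal E(f)\le\lambda\|f\|_2^2$ for all $f\in V$. Then for all $0\le\lambda<\infty$ $$F_\Omega^{\dim}(\lambda)\le 8\,\mu(\Omega)\,\lambda\,G(8\lambda).$$ 3. For all $0\le\lambda<\infty$ one has $F(\lambda)\le\lambda\,G(\lambda)$. -/

import Mathlib

open MeasureTheory Filter Topology
open scoped ENNReal NNReal InnerProductSpace

namespace MixedState

noncomputable section

/-! ## Positive self-adjoint operators on a Hilbert space -/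

section Hilbert

variable {E : Type*} [NormedAddCommGroup E] [InnerProductSpace ℂ E] [CompleteSpace E]

/-- A (possibly unbounded) positive self-adjoint operator. In Mathlib a self-adjoint `LinearPMap`
is automatically densely defined. -/
structure IsPositiveSelfAdjoint (A : E →ₗ.[ℂ] E) : Prop where
  selfAdjoint : IsSelfAdjoint A
  nonneg : ∀ f : A.domain, 0 ≤ (⟪(f : E), A f⟫_ℂ).re

/-- The kernel of `A`, as a subspace of the Hilbert space. -/
def kernel (A : E →ₗ.[ℂ] E) : Submodule ℂ E :=
  (LinearMap.ker A.toFun).map A.domain.subtype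

/-- `R` is the bounded operator `(1 + A)⁻¹`. -/
def IsResolvent (A : E →ₗ.[ℂ] E) (R : E →L[ℂ] E) : Prop :=
  ∀ f : E, ∃ h : R f ∈ A.domain, R f + A ⟨R f, h⟩ = f

theorem norm_le_norm_add {A : E →ₗ.[ℂ] E} (hA : IsPositiveSelfAdjoint A) (f : A.domain) :
    ‖(f : E)‖ ≤ ‖(f : E) + A f‖ := by
  have h1 : ‖(f : E)‖ ^ 2 ≤ ‖(f : E)‖ * ‖(f : E) + A f‖ := by
    have h2 := hA.nonneg f
    have h3 : (⟪(f : E), (f : E) + A f⟫_ℂ).re ≤ ‖(f : E)‖ * ‖(f : E) + A f‖ :=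
      re_inner_le_norm (𝕜 := ℂ) _ _
    rw [inner_add_right, Complex.add_re] at h3
    have h4 : (⟪(f : E), (f : E)⟫_ℂ).re = ‖(f : E)‖ ^ 2 :=
      inner_self_eq_norm_sq (𝕜 := ℂ) (f : E)
    linarith
  rcases (norm_nonneg (f : E)).eq_or_lt with h | h
  · rw [← h]; positivity
  · nlinarith

/-- The operator `(1 + A)⁻¹` exists for every positive self-adjoint `A`. -/
theorem exists_resolvent {A : E →ₗ.[ℂ] E} (hA : IsPositiveSelfAdjoint A) :
    ∃ R : E →L[ℂ] E, IsResolvent A R := by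
  have hd := hA.selfAdjoint.dense_domain
  have hadj : A.adjoint = A := LinearPMap.isSelfAdjoint_def.mp hA.selfAdjoint
  let T : A.domain →ₗ[ℂ] E := A.domain.subtype + A.toFun
  have hT : ∀ f : A.domain, T f = (f : E) + A f := fun f => rfl
  have hTn : ∀ f : A.domain, ‖f‖ ≤ ‖T f‖ := fun f => norm_le_norm_add hA f
  -- the range is closed
  have hcl : IsClosed (LinearMap.range T : Set E) := by
    refine IsSeqClosed.isClosed ?_
    intro y a hy hya
    choose x hx using hy
    have hcauchy : CauchySeq (fun n => ((x n : A.domain) : E)) := by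
      have hyc := hya.cauchySeq
      rw [Metric.cauchySeq_iff] at hyc ⊢
      intro ε hε
      obtain ⟨N, hN⟩ := hyc ε hε
      refine ⟨N, fun m hm n hn => ?_⟩
      refine lt_of_le_of_lt ?_ (hN m hm n hn)
      rw [dist_eq_norm, dist_eq_norm, ← hx m, ← hx n, ← map_sub]
      exact hTn (x m - x n)
    obtain ⟨b, hb⟩ := cauchySeq_tendsto_of_complete hcauchy
    have hAx : Tendsto (fun n => A (x n)) atTop (𝓝 (a - b)) := by
      have : (fun n => A (x n)) = fun n => y n - (x n : E) := by
        funext n; rw [← hx n, hT]; abel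
      rw [this]
      exact hya.sub hb
    have hgr : (b, a - b) ∈ A.graph := by
      have hc := hA.selfAdjoint.isClosed
      refine hc.mem_of_tendsto (hb.prodMk_nhds hAx) (Eventually.of_forall fun n => ?_)
      exact A.mem_graph (x n)
    rw [LinearPMap.mem_graph_iff] at hgr
    obtain ⟨c, hc1, hc2⟩ := hgr
    refine ⟨c, ?_⟩
    rw [hT, hc2]
    simp only at hc1 ⊢
    rw [hc1]; abel
  have htop : LinearMap.range T = ⊤ := by
    have : CompleteSpace (LinearMap.range T) := hcl.completeSpace_coe
    rw [← Submodule.orthogonal_eq_bot_iff, Submodule.eq_bot_iff]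
    intro g hg
    have hg' : ∀ x : A.domain, ⟪-g, (x : E)⟫_ℂ = ⟪g, A x⟫_ℂ := by
      intro x
      have h0 : ⟪g, T x⟫_ℂ = 0 := by
        rw [← inner_conj_symm, (Submodule.mem_orthogonal _ _).mp hg (T x) ⟨x, rfl⟩, map_zero]
      rw [hT, inner_add_right] at h0
      rw [inner_neg_left]
      linear_combination -h0
    have hmem : g ∈ A.adjoint.domain := LinearPMap.mem_adjoint_domain_of_exists g ⟨-g, hg'⟩
    have hval : A.adjoint ⟨g, hmem⟩ = -g := LinearPMap.adjoint_apply_eq hd ⟨g, hmem⟩ hg'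
    have hgr : (g, -g) ∈ A.graph := by
      rw [← hadj, LinearPMap.mem_graph_iff]
      exact ⟨⟨g, hmem⟩, rfl, hval⟩
    rw [LinearPMap.mem_graph_iff] at hgr
    obtain ⟨c, hc1, hc2⟩ := hgr
    have h5 := norm_le_norm_add hA c
    rw [hc2, hc1] at h5
    simpa using h5
  have hinj : Function.Injective T := by
    rw [injective_iff_map_eq_zero]
    intro f hf
    have := hTn f
    rw [hf, norm_zero] at this
    exact norm_le_zero_iff.mp this
  let e : A.domain ≃ₗ[ℂ] E := LinearEquiv.ofBijective T ⟨hinj, LinearMap.range_eq_top.mp htop⟩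
  have he : ∀ f, T (e.symm f) = f := fun f => e.apply_symm_apply f
  refine ⟨LinearMap.mkContinuous (A.domain.subtype ∘ₗ (e.symm : E →ₗ[ℂ] A.domain)) 1 ?_, ?_⟩
  · intro f
    have h6 := hTn (e.symm f)
    rw [he] at h6
    simpa using h6
  · intro f
    exact ⟨(e.symm f).2, he f⟩

open Classical in
/-- The bounded operator `(1 + A)⁻¹` (it is unique when it exists, and it exists for every positive
self-adjoint `A`, see `exists_resolvent`). -/
def resolventOp (A : E →ₗ.[ℂ] E) : E →L[ℂ] E :=
  if h : ∃ R : E →L[ℂ] E, IsResolvent A R then h.choose else 0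

/-- The bounded operator `((1 + l)⁻¹ - (1 + A)⁻¹)⁺`. It is the image of `A` under the continuous
function `u ↦ ((1 + l)⁻¹ - (1 + u)⁻¹)⁺`, which on `[0, ∞)` vanishes exactly on `[0, l]`. -/
def cutoff (A : E →ₗ.[ℂ] E) (l : ℝ≥0) : E →L[ℂ] E :=
  cfc (fun x : ℝ => max ((1 + (l : ℝ))⁻¹ - x) 0) (resolventOp A)

/-- The range `E_l` of the spectral projection of `A` on `]0, l]`. The kernel of
`((1 + l)⁻¹ - (1 + A)⁻¹)⁺` is the range of the spectral projection of `A` on `[0, l]`; intersecting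
with the orthogonal of `ker A` removes the point `0`. -/
def spectralSubspace (A : E →ₗ.[ℂ] E) (l : ℝ≥0) : Submodule ℂ E :=
  LinearMap.ker (cutoff A l : E →ₗ[ℂ] E) ⊓ (kernel A)ᗮ

instance (A : E →ₗ.[ℂ] E) (l : ℝ≥0) : (spectralSubspace A l).HasOrthogonalProjection := by
  have h1 : IsClosed (spectralSubspace A l : Set E) :=
    (cutoff A l).isClosed_ker.inter (Submodule.isClosed_orthogonal _)
  have : CompleteSpace (spectralSubspace A l) := h1.completeSpace_coe
  infer_instance

/-- The spectral projection `Π_l = χ_A(]0, l])`. -/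
def spectralProj (A : E →ₗ.[ℂ] E) (l : ℝ≥0) : E →L[ℂ] E :=
  (spectralSubspace A l).starProjection

theorem spectralSubspace_mono (A : E →ₗ.[ℂ] E) : Monotone (spectralSubspace A) := by
  intro l m hlm
  refine inf_le_inf_right _ ?_
  intro f hf
  have hf0 : cutoff A l f = 0 := hf
  change cutoff A m f = 0
  have hle : cutoff A m ≤ cutoff A l := by
    refine cfc_mono (fun x _ => ?_)
    have : (1 + (m : ℝ))⁻¹ ≤ (1 + (l : ℝ))⁻¹ := by
      have : (l : ℝ) ≤ m := hlm
      gcongr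
    exact max_le_max (by linarith) le_rfl
  have hpos : 0 ≤ cutoff A m := cfc_nonneg (fun x _ => le_max_right _ _)
  have hpos' := (ContinuousLinearMap.nonneg_iff_isPositive _).mp hpos
  have hfm : (cutoff A m).reApplyInnerSelf f ≤ 0 := by
    have h1 := ((ContinuousLinearMap.le_def _ _).mp hle).2 f
    simpa [ContinuousLinearMap.reApplyInnerSelf, hf0, inner_sub_left] using h1
  have hsq : (CFC.sqrt (cutoff A m)) * (CFC.sqrt (cutoff A m)) = cutoff A m :=
    CFC.sqrt_mul_sqrt_self _ hpos
  have hsa : (CFC.sqrt (cutoff A m)).IsPositive :=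
    (ContinuousLinearMap.nonneg_iff_isPositive _).mp (CFC.sqrt_nonneg _)
  have h2 : ‖CFC.sqrt (cutoff A m) f‖ ^ 2 ≤ 0 := by
    refine le_trans (le_of_eq ?_) hfm
    rw [← inner_self_eq_norm_sq (𝕜 := ℂ), hsa.inner_left_eq_inner_right, ← mul_apply_eq_comp, hsq,
      ContinuousLinearMap.reApplyInnerSelf, ← hpos'.inner_left_eq_inner_right]
  have h3 : CFC.sqrt (cutoff A m) f = 0 := by
    rw [← norm_eq_zero]
    nlinarith [norm_nonneg (CFC.sqrt (cutoff A m) f)]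
  rw [← hsq, mul_apply_eq_comp, h3, map_zero]

theorem spectralProj_mono (A : E →ₗ.[ℂ] E) : Monotone (spectralProj A) := fun _ _ h =>
  Submodule.starProjection_le_starProjection_iff.mpr (spectralSubspace_mono A h)

/-- The energy `𝓔(f) = ‖A^{1/2} f‖² ∈ [0, ∞]`, that is, the closure (greatest lower semicontinuous
extension) of the quadratic form `f ↦ ⟨A f, f⟩` from the domain of `A` to the whole space. It is
`∞` off the form domain, the domain of `A^{1/2}`. -/
def energy (A : E →ₗ.[ℂ] E) (f : E) : ℝ≥0∞ :=
  liminf (fun g : A.domain => ENNReal.ofReal (⟪(g : E), A g⟫_ℂ).re)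
    (comap (fun g : A.domain => (g : E)) (𝓝 f))

variable (E) in
/-- The index set of a fixed Hilbert basis. -/
def basisIndex : Set E := (exists_hilbertBasis ℂ E).choose

variable (E) in
/-- A fixed Hilbert basis. Nothing below depends on the choice. -/
def basis : HilbertBasis (basisIndex E) ℂ E := (exists_hilbertBasis ℂ E).choose_spec.choose

/-- The trace `τ(P) = ∑ ⟨P e_i, e_i⟩ ∈ [0, ∞]` of a bounded positive operator `P`. -/
def trace (P : E →L[ℂ] E) : ℝ≥0∞ :=
  ∑' i, ENNReal.ofReal (⟪basis E i, P (basis E i)⟫_ℂ).re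

theorem trace_mono {P Q : E →L[ℂ] E} (h : P ≤ Q) : trace P ≤ trace Q := by
  refine ENNReal.tsum_le_tsum fun i => ENNReal.ofReal_le_ofReal ?_
  have h1 := ((ContinuousLinearMap.le_def _ _).mp h).re_inner_nonneg_right (basis E i)
  simpa [inner_sub_right] using h1

/-- The energy `𝓔(ρ) = τ(ρ^{1/2} A ρ^{1/2}) ∈ [0, ∞]` of a bounded positive operator `ρ`: the sum
of the `⟨A ρ^{1/2} e_i, ρ^{1/2} e_i⟩ = 𝓔(ρ^{1/2} e_i)` over a Hilbert basis. -/
def stateEnergy (A : E →ₗ.[ℂ] E) (ρ : E →L[ℂ] E) : ℝ≥0∞ :=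
  ∑' i, energy A (CFC.sqrt ρ (basis E i))

/-- The `L²-L²` norm of the positive operator `ρ^{1/2} A ρ^{1/2}`, in `[0, ∞]`: the supremum of its
quadratic form `⟨A ρ^{1/2} f, ρ^{1/2} f⟩ = 𝓔(ρ^{1/2} f)` over the unit ball. -/
def stateNorm (A : E →ₗ.[ℂ] E) (ρ : E →L[ℂ] E) : ℝ≥0∞ :=
  ⨆ (f : E) (_ : ‖f‖ ≤ 1), energy A (CFC.sqrt ρ f)

/-- The expectation value `⟨A⟩_ρ = 𝓔(ρ) / τ(ρ)`. -/
def expectation (A : E →ₗ.[ℂ] E) (ρ : E →L[ℂ] E) : ℝ≥0∞ :=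
  stateEnergy A ρ / trace ρ

end Hilbert

/-! ## Densities of positive operators on `L²(X, H)` -/

section Density

variable {X : Type*} [MeasurableSpace X] {μ : Measure X}
  {H : Type*} [NormedAddCommGroup H] [InnerProductSpace ℂ H]

/-- Multiplication by the indicator function of `Ω` on `L²(X, H)`. -/
def indicatorOp (μ : Measure X) (H : Type*) [NormedAddCommGroup H] [InnerProductSpace ℂ H]
    {Ω : Set X} (hΩ : MeasurableSet Ω) : Lp H 2 μ →L[ℂ] Lp H 2 μ :=
  LinearMap.mkContinuous
    { toFun := fun f => ((Lp.memLp f).indicator hΩ).toLp (Ω.indicator f)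
      map_add' := by
        intro f g
        rw [← MemLp.toLp_add]
        refine MemLp.toLp_congr _ _ ?_
        filter_upwards [Lp.coeFn_add f g] with x hx
        by_cases h : x ∈ Ω
        · rw [Pi.add_apply, Set.indicator_of_mem h, Set.indicator_of_mem h, Set.indicator_of_mem h]
          exact hx
        · simp [h]
      map_smul' := by
        intro c f
        rw [RingHom.id_apply, ← MemLp.toLp_const_smul]
        refine MemLp.toLp_congr _ _ ?_
        filter_upwards [Lp.coeFn_smul c f] with x hx
        by_cases h : x ∈ Ω
        · rw [Pi.smul_apply, Set.indicator_of_mem h, Set.indicator_of_mem h]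
          exact hx
        · simp [h] }
    1 (by
      intro f
      rw [one_mul]
      refine Lp.norm_le_norm_of_ae_le ?_
      filter_upwards [((Lp.memLp f).indicator hΩ).coeFn_toLp] with x hx
      simp only [LinearMap.coe_mk, AddHom.coe_mk, hx]
      exact norm_indicator_le_norm_self _ _)

theorem coeFn_indicatorOp {Ω : Set X} (hΩ : MeasurableSet Ω) (f : Lp H 2 μ) :
    indicatorOp μ H hΩ f =ᵐ[μ] Ω.indicator f :=
  ((Lp.memLp f).indicator hΩ).coeFn_toLp

theorem inner_indicatorOp {Ω : Set X} (hΩ : MeasurableSet Ω) (f g : Lp H 2 μ) :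
    ⟪indicatorOp μ H hΩ f, g⟫_ℂ = ⟪f, indicatorOp μ H hΩ g⟫_ℂ := by
  rw [L2.inner_def, L2.inner_def]
  refine integral_congr_ae ?_
  filter_upwards [coeFn_indicatorOp hΩ f, coeFn_indicatorOp hΩ g] with x hf hg
  rw [hf, hg]
  by_cases h : x ∈ Ω <;> simp [h]

variable [CompleteSpace H]

/-- The measure `ν_P(Ω) = τ(χ_Ω P χ_Ω)` of a measurable set `Ω`, for a bounded positive `P`. -/
def nu (P : Lp H 2 μ →L[ℂ] Lp H 2 μ) {Ω : Set X} (hΩ : MeasurableSet Ω) : ℝ≥0∞ :=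
  trace (indicatorOp μ H hΩ ∘L P ∘L indicatorOp μ H hΩ)

/-- The density `D(P) = sup_Ω ν_P(Ω) / μ(Ω) ∈ [0, ∞]`, over all measurable `Ω`. (If `μ(Ω) = 0` then
`ν_P(Ω) = 0` and the quotient is read as `0`; it is also read as `0` if `μ(Ω) = ∞`.) -/
def density (P : Lp H 2 μ →L[ℂ] Lp H 2 μ) : ℝ≥0∞ :=
  ⨆ (Ω : Set X) (hΩ : MeasurableSet Ω), nu P hΩ / μ Ω

theorem density_mono {P Q : Lp H 2 μ →L[ℂ] Lp H 2 μ} (h : P ≤ Q) : density P ≤ density Q := by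
  refine iSup₂_mono fun Ω hΩ => ?_
  refine ENNReal.div_le_div_right (trace_mono ?_) _
  have hadj : (indicatorOp μ H hΩ).adjoint = indicatorOp μ H hΩ := by
    refine ((ContinuousLinearMap.eq_adjoint_iff _ _).mpr fun f g => ?_).symm
    exact inner_indicatorOp hΩ f g
  have h1 := ((ContinuousLinearMap.le_def _ _).mp h).adjoint_conj (indicatorOp μ H hΩ)
  rw [hadj] at h1
  rw [ContinuousLinearMap.le_def]
  convert h1 using 1
  ext1 f
  simp

/-- `F(l) = D(Π_l)`, the density of the spectral projection of `A` on `]0, l]`. -/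
def spectralDensity (A : Lp H 2 μ →ₗ.[ℂ] Lp H 2 μ) (l : ℝ≥0) : ℝ≥0∞ :=
  density (spectralProj A l)

theorem spectralDensity_mono (A : Lp H 2 μ →ₗ.[ℂ] Lp H 2 μ) : Monotone (spectralDensity A) :=
  fun _ _ h => density_mono (spectralProj_mono A h)

/-- `f` vanishes almost everywhere outside `Ω`. -/
def SupportedIn (Ω : Set X) (f : Lp H 2 μ) : Prop :=
  ∀ᵐ x ∂μ, x ∉ Ω → f x = 0

/-- `F_Ω^dim(l)`: the supremum of `dim V` over the linear subspaces `V` of `L²(X, H)` which are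
orthogonal to `ker A`, consist of functions supported in `Ω`, and satisfy `𝓔(f) ≤ l ‖f‖²` for all
`f` in `V`. -/
def dimCount (A : Lp H 2 μ →ₗ.[ℂ] Lp H 2 μ) (Ω : Set X) (l : ℝ≥0) : ℝ≥0∞ :=
  ⨆ (V : Submodule ℂ (Lp H 2 μ)) (_ : V ≤ (kernel A)ᗮ) (_ : ∀ f ∈ V, SupportedIn Ω f)
    (_ : ∀ f ∈ V, energy A f ≤ l * ENNReal.ofReal (‖f‖ ^ 2)),
    ((Cardinal.toENat (Module.rank ℂ V) : ℕ∞) : ℝ≥0∞)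

end Density

/-! ## The Stieltjes integral `∫ dF(u) / u` -/

/-- The increasing function `u ↦ F(min(u, l))` on the real line, equal to `F(0)` for `u < 0`. -/
def stopped (F : ℝ≥0 → ℝ≥0∞) (l : ℝ≥0) (u : ℝ) : ℝ := (F (min u.toNNReal l)).toReal

theorem stopped_mono {F : ℝ≥0 → ℝ≥0∞} (hF : Monotone F) (hfin : ∀ l, F l ≠ ∞) (l : ℝ≥0) :
    Monotone (stopped F l) := fun _ _ h =>
  ENNReal.toReal_mono (hfin _) (hF (min_le_min_right _ (Real.toNNReal_le_toNNReal h)))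

/-- The Stieltjes integral `∫_{[0, l]} dF(u) / u ∈ [0, ∞]` of a finite increasing `F`. The jump of
`F` at `0` is charged with `1 / 0 = ∞`. Stopping `F` at `l` makes the end point `l` contribute
`(F(l) - F(l-)) / l` even if `F` is not right continuous at `l`; for a right continuous `F` the
measure is the usual `dF` on `[0, l]`. -/
def stieltjes (F : ℝ≥0 → ℝ≥0∞) (hF : Monotone F) (hfin : ∀ l, F l ≠ ∞) (l : ℝ≥0) : ℝ≥0∞ :=
  ∫⁻ u in Set.Icc (0 : ℝ) l, (ENNReal.ofReal u)⁻¹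
    ∂((stopped_mono hF hfin l).stieltjesFunction.measure)

/-- The increasing function `l ↦ ∫_{[0, l]} dF(u) / u`, extended to `l = ∞` by its supremum. -/
def stieltjesExt (F : ℝ≥0 → ℝ≥0∞) (hF : Monotone F) (hfin : ∀ l, F l ≠ ∞) (l : ℝ≥0∞) : ℝ≥0∞ :=
  ⨆ (s : ℝ≥0) (_ : (s : ℝ≥0∞) ≤ l), stieltjes F hF hfin s

end

end MixedState

namespace MixedState

/-! ### The resolvent as a bounded substitute for the operator -/

section Resolvent

variable {E : Type*} [NormedAddCommGroup E] [InnerProductSpace ℂ E] [CompleteSpace E]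
  {A : E →ₗ.[ℂ] E}

/-! Let `Π_l` be the spectral projection on `]0, l]` and `K` the norm of `ρ^{1/2} A ρ^{1/2}`.
Formally, Cauchy-Schwarz gives `|⟨h, Π_l g⟩|² ≤ 𝓔(h) ⟨A⁻¹ Π_l g, g⟩` for `h ⟂ ker A`. Summed over `g
= χ_Ω e_i`, the last factor becomes `τ(χ_Ω A⁻¹ Π_l χ_Ω)`. Since `1 / u` decreases and `ν_{Π_u}(Ω) ≤
μ(Ω) F(u)`, an integration by parts bounds it by `μ(Ω) G(l)`. This controls the Hilbert-Schmidt norm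
of `χ_Ω Π_l ρ^{1/2}` by `K μ(Ω) G(l)`, up to a factor. Frequencies above `l` cost energy: `‖h - Π_l
h‖² ≤ 𝓔(h) / l`. As `χ_Ω ρ^{1/2} = ρ^{1/2}`, the two pieces give `τ(ρ) ≤ 4 K μ(Ω) G(l) + 2 𝓔(ρ) /
l`. At `l = 8 ⟨A⟩_ρ` the last term is `τ(ρ) / 4` and is absorbed; if `𝓔(ρ) = ∞`, let `l → ∞` instead
(`trace_le_mul_stieltjesExt`).

No spectral integral is formed. `A⁻¹` is replaced by a weight constant on the dyadic shells `]l /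
2^(k+1), l / 2^k]`, at the cost of a factor 2 (`ofReal_norm_sq_inner_sub_le`). Abel summation turns
shells into the values `F(l / 2^(k+1))`, and `add_tsum_le_mul_stieltjes` compares these with `G`.
The bound `A ≥ l` above level `l` comes from the functional calculus of the resolvent
(`mul_norm_sq_resolventOp_le`).

The dimension bound is the case where `ρ` is the projection on a finite dimensional subspace. The
third bound only uses `1 / u ≥ 1 / l` on `[0, l]`. -/

theorem isResolvent_resolventOp (hA : IsPositiveSelfAdjoint A) :
    IsResolvent A (resolventOp A) := by
  have h := exists_resolvent hA
  rw [resolventOp, dif_pos h]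
  exact h.choose_spec

theorem IsPositiveSelfAdjoint.inner_apply_left (hA : IsPositiveSelfAdjoint A) (x y : A.domain) :
    ⟪A x, (y : E)⟫_ℂ = ⟪(x : E), A y⟫_ℂ := by
  have h := LinearPMap.adjoint_isFormalAdjoint (T := A) hA.selfAdjoint.dense_domain
  rw [LinearPMap.isSelfAdjoint_def.mp hA.selfAdjoint] at h
  exact h x y

theorem resolventOp_add_apply (hA : IsPositiveSelfAdjoint A) (x : A.domain) :
    resolventOp A ((x : E) + A x) = x := by
  obtain ⟨h, hx⟩ := isResolvent_resolventOp hA ((x : E) + A x)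
  have h1 := norm_le_norm_add hA (⟨_, h⟩ - x)
  have h2 : (((⟨_, h⟩ - x : A.domain) : E) + A (⟨_, h⟩ - x)) = 0 := by
    rw [LinearPMap.map_sub, AddSubgroupClass.coe_sub]
    rw [← sub_eq_zero] at hx
    rw [← hx]
    abel
  rw [h2, norm_zero, norm_le_zero_iff, AddSubgroupClass.coe_sub, sub_eq_zero] at h1
  exact h1

theorem inner_resolventOp_left (hA : IsPositiveSelfAdjoint A) (f g : E) :
    ⟪resolventOp A f, g⟫_ℂ = ⟪f, resolventOp A g⟫_ℂ := by
  obtain ⟨hf, hf'⟩ := isResolvent_resolventOp hA f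
  obtain ⟨hg, hg'⟩ := isResolvent_resolventOp hA g
  have h := hA.inner_apply_left ⟨_, hf⟩ ⟨_, hg⟩
  conv_lhs => rw [← hg']
  conv_rhs => rw [← hf']
  rw [inner_add_right, inner_add_left, h]

theorem isSelfAdjoint_resolventOp (hA : IsPositiveSelfAdjoint A) :
    IsSelfAdjoint (resolventOp A) :=
  ((ContinuousLinearMap.eq_adjoint_iff _ _).mpr (inner_resolventOp_left hA)).symm

/-- With `h = R w`, where `R = (1 + A)⁻¹`, one has `A h = w - R w`. This bounded form in `w` is
therefore `⟨h, A h⟩`, and it replaces the unbounded form in the spectral arguments below. -/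
theorem re_inner_resolventOp_sub_nonneg (hA : IsPositiveSelfAdjoint A) (w : E) :
    0 ≤ (⟪resolventOp A w, w - resolventOp A w⟫_ℂ).re := by
  obtain ⟨hf, hf'⟩ := isResolvent_resolventOp hA w
  have h := hA.nonneg ⟨_, hf⟩
  rwa [← eq_sub_iff_add_eq'.mpr hf']

theorem resolventOp_nonneg (hA : IsPositiveSelfAdjoint A) : 0 ≤ resolventOp A := by
  rw [ContinuousLinearMap.nonneg_iff_isPositive]
  refine ContinuousLinearMap.isPositive_def.mpr
    ⟨(isSelfAdjoint_resolventOp hA).isSymmetric, fun w => ?_⟩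
  have h := re_inner_resolventOp_sub_nonneg hA w
  rw [inner_sub_right, Complex.sub_re] at h
  have h1 : (⟪resolventOp A w, resolventOp A w⟫_ℂ).re = ‖resolventOp A w‖ ^ 2 :=
    inner_self_eq_norm_sq (𝕜 := ℂ) _
  rw [ContinuousLinearMap.reApplyInnerSelf]
  change 0 ≤ (⟪resolventOp A w, w⟫_ℂ).re
  nlinarith [sq_nonneg ‖resolventOp A w‖]

theorem resolventOp_le_one (hA : IsPositiveSelfAdjoint A) : resolventOp A ≤ 1 := by
  rw [ContinuousLinearMap.le_def]
  refine ContinuousLinearMap.isPositive_def.mpr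
    ⟨((IsSelfAdjoint.one _).sub (isSelfAdjoint_resolventOp hA)).isSymmetric, fun w => ?_⟩
  rw [ContinuousLinearMap.reApplyInnerSelf]
  change 0 ≤ (⟪w - resolventOp A w, w⟫_ℂ).re
  have h := re_inner_resolventOp_sub_nonneg hA w
  have h1 : (⟪w - resolventOp A w, w - resolventOp A w⟫_ℂ).re = ‖w - resolventOp A w‖ ^ 2 :=
    inner_self_eq_norm_sq (𝕜 := ℂ) _
  have h3 : (⟪w - resolventOp A w, resolventOp A w⟫_ℂ).re
      = (⟪resolventOp A w, w - resolventOp A w⟫_ℂ).re := inner_re_symm (𝕜 := ℂ) _ _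
  have h4 : (⟪w - resolventOp A w, w⟫_ℂ).re
      = (⟪w - resolventOp A w, (w - resolventOp A w) + resolventOp A w⟫_ℂ).re := by
    rw [sub_add_cancel]
  rw [h4, inner_add_right, Complex.add_re, h1, h3]
  positivity

theorem resolventOp_apply_eq_self (hA : IsPositiveSelfAdjoint A) {f : E} (hf : f ∈ kernel A) :
    resolventOp A f = f := by
  obtain ⟨x, hx, rfl⟩ := hf
  have h := resolventOp_add_apply hA x
  have hx' : A x = 0 := hx
  rwa [hx', add_zero] at h

theorem mem_kernel_of_resolventOp_apply_eq_self (hA : IsPositiveSelfAdjoint A) {f : E}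
    (hf : resolventOp A f = f) : f ∈ kernel A := by
  obtain ⟨h, h'⟩ := isResolvent_resolventOp hA f
  refine ⟨⟨_, h⟩, ?_, hf⟩
  change A ⟨_, h⟩ = 0
  exact add_eq_left.mp (h'.trans hf.symm)

theorem isSelfAdjoint_cutoff (l : ℝ≥0) : IsSelfAdjoint (cutoff A l) := cfc_predicate _ _

theorem commute_cutoff_resolventOp (l : ℝ≥0) : Commute (cutoff A l) (resolventOp A) :=
  ((Commute.refl (resolventOp A)).cfc_real _)

/-- On the orthogonal of the kernel of the cutoff, `A ≥ l`, in terms of the resolvent. -/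
theorem mul_norm_sq_resolventOp_le (hA : IsPositiveSelfAdjoint A) (l : ℝ≥0) {w : E}
    (hw : w ∈ (LinearMap.ker (cutoff A l : E →ₗ[ℂ] E))ᗮ) :
    l * ‖resolventOp A w‖ ^ 2 ≤ (⟪resolventOp A w, w - resolventOp A w⟫_ℂ).re := by
  set R := resolventOp A with hR
  have hsa : IsSelfAdjoint R := isSelfAdjoint_resolventOp hA
  set c : ℝ := (1 + (l : ℝ))⁻¹ with hc
  have hcl : c * (1 + l) = 1 := inv_mul_cancel₀ (by positivity)
  let D : E →L[ℂ] E := cfc (fun x : ℝ => x * max (x - c) 0) R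
  let Bp : E →L[ℂ] E := cfc (fun x : ℝ => x * max (c - x) 0) R
  have hD : cutoff A l * D = 0 := by
    change cfc _ R * cfc _ R = 0
    rw [← cfc_mul _ _ R (by fun_prop) (by fun_prop), ← cfc_zero ℝ R]
    refine cfc_congr fun x _ => ?_
    change max (c - x) 0 * (x * max (x - c) 0) = 0
    rcases le_total x c with h | h
    · rw [max_eq_right (sub_nonpos.mpr h)]; ring
    · rw [max_eq_right (sub_nonpos.mpr h)]; ring
  -- The range of `D` lies in the kernel of the cutoff, to which `w` is orthogonal; self-adjointness
  -- then gives `D w = 0`.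
  have hDsa : IsSelfAdjoint D := cfc_predicate _ _
  have hDw : D w = 0 := by
    have h1 : D (D w) ∈ LinearMap.ker (cutoff A l : E →ₗ[ℂ] E) := by
      change (cutoff A l * D) (D w) = 0
      rw [hD]; rfl
    have h2 := (Submodule.mem_orthogonal _ _).mp hw _ h1
    have h3 : ⟪D (D w), w⟫_ℂ = ⟪D w, D w⟫_ℂ := hDsa.isSymmetric (D w) w
    rw [h3] at h2
    exact inner_self_eq_zero.mp h2
  have hBp : 0 ≤ Bp := by
    refine cfc_nonneg fun x hx => mul_nonneg ?_ (le_max_right _ _)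
    exact spectrum_nonneg_of_nonneg (resolventOp_nonneg hA) hx
  -- This is `x (c - x)` split into positive and negative parts. On `w` only the positive part
  -- survives, so `⟨(c R - R²) w, w⟩ ≥ 0`; multiplying by `1 + l = 1 / c` gives the claim.
  have hdec : c • R - R * R = Bp - D := by
    have h1 : cfc (fun x : ℝ => x * (c - x)) R = c • R - R * R := by
      rw [show (fun x : ℝ => x * (c - x)) = fun x : ℝ => c • x - x * x from by
        funext x; simp only [smul_eq_mul]; ring]
      rw [cfc_sub _ _ R (by fun_prop) (by fun_prop), cfc_smul _ _ R (by fun_prop),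
        cfc_mul _ _ R (by fun_prop) (by fun_prop), cfc_id' ℝ R]
    rw [← h1, ← cfc_sub _ _ R (by fun_prop) (by fun_prop)]
    refine cfc_congr fun x _ => ?_
    change x * (c - x) = x * max (c - x) 0 - x * max (x - c) 0
    rcases le_total x c with h | h
    · rw [max_eq_left (sub_nonneg.mpr h), max_eq_right (sub_nonpos.mpr h)]; ring
    · rw [max_eq_right (sub_nonpos.mpr h), max_eq_left (sub_nonneg.mpr h)]; ring
  have hpos : 0 ≤ (⟪w, Bp w⟫_ℂ).re :=
    ((ContinuousLinearMap.nonneg_iff_isPositive _).mp hBp).re_inner_nonneg_right w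
  have h4 : Bp w = (c : ℂ) • R w - R (R w) := by
    have := congrArg (fun T : E →L[ℂ] E => T w) hdec
    simp only [sub_apply, hDw, sub_zero] at this
    rw [← this]; simp
  have h5 : ⟪w, R (R w)⟫_ℂ = ⟪R w, R w⟫_ℂ := (hsa.isSymmetric w (R w)).symm
  have h6 : (⟪R w, R w⟫_ℂ).re = ‖R w‖ ^ 2 := inner_self_eq_norm_sq (𝕜 := ℂ) _
  have h7 : ⟪w, R w⟫_ℂ = ⟪R w, w⟫_ℂ := (hsa.isSymmetric w w).symm
  rw [h4, inner_sub_right, inner_smul_right, Complex.sub_re, h5, h6, h7, Complex.re_ofReal_mul]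
    at hpos
  rw [inner_sub_right, Complex.sub_re, h6]
  have h8 : (c * (⟪R w, w⟫_ℂ).re - ‖R w‖ ^ 2) * (1 + l)
      = (⟪R w, w⟫_ℂ).re - ‖R w‖ ^ 2 * (1 + l) := by
    linear_combination (⟪R w, w⟫_ℂ).re * hcl
  have h9 : 0 ≤ (c * (⟪R w, w⟫_ℂ).re - ‖R w‖ ^ 2) * (1 + l) := mul_nonneg hpos (by positivity)
  linarith

/-- The spectrum of `R` lies in `[0, 1]`, where `((c - x)⁺)² ≤ (c - x)⁺ (1 - x)` for `c = (1 + l)⁻¹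
≤ 1`, and `1 - R` kills `ker A`. -/
theorem kernel_le_ker_cutoff (hA : IsPositiveSelfAdjoint A) (l : ℝ≥0) :
    kernel A ≤ LinearMap.ker (cutoff A l : E →ₗ[ℂ] E) := by
  intro f hf
  have hsa : IsSelfAdjoint (resolventOp A) := isSelfAdjoint_resolventOp hA
  have h1 : cutoff A l * cutoff A l ≤ cutoff A l * (1 - resolventOp A) := by
    have h2 : 1 - resolventOp A = cfc (fun x : ℝ => 1 - x) (resolventOp A) := by
      rw [cfc_sub _ _ _ (by fun_prop) (by fun_prop), cfc_const_one ℝ _, cfc_id' ℝ _]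
    rw [h2, cutoff, ← cfc_mul _ _ _ (by fun_prop) (by fun_prop),
      ← cfc_mul _ _ _ (by fun_prop) (by fun_prop)]
    refine cfc_mono (fun x hx => ?_)
    have hx1 : x ≤ 1 := by
      refine (le_algebraMap_iff_spectrum_le (R := ℝ) hsa).mp ?_ x hx
      rw [map_one]
      exact resolventOp_le_one hA
    refine mul_le_mul_of_nonneg_left ?_ (le_max_right _ _)
    refine max_le ?_ (by linarith)
    have : (1 + (l : ℝ))⁻¹ ≤ 1 := inv_le_one_of_one_le₀ (by simp)
    linarith
  have h3 := ((ContinuousLinearMap.le_def _ _).mp h1).re_inner_nonneg_right f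
  have h4 : (cutoff A l * (1 - resolventOp A)) f = 0 := by
    simp [resolventOp_apply_eq_self hA hf]
  have h5 : ⟪f, (cutoff A l * cutoff A l) f⟫_ℂ = ⟪cutoff A l f, cutoff A l f⟫_ℂ :=
    ((isSelfAdjoint_cutoff l).isSymmetric f (cutoff A l f)).symm
  rw [sub_apply, h4, zero_sub, inner_neg_right, h5] at h3
  have h6 : (⟪cutoff A l f, cutoff A l f⟫_ℂ).re = ‖cutoff A l f‖ ^ 2 :=
    inner_self_eq_norm_sq (𝕜 := ℂ) _
  have h7 : ‖cutoff A l f‖ ^ 2 ≤ 0 := by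
    rw [← h6]
    simpa using h3
  change cutoff A l f = 0
  rw [← norm_eq_zero]
  nlinarith [norm_nonneg (cutoff A l f)]

end Resolvent

/-! ### Spectral lower bounds for the energy -/

section SpectralDecomposition

/-- The energy is a liminf of the form of `A` over domain points tending to `f`, so a continuous
minorant on the domain passes to the limit. All lower bounds of the energy are obtained this way. -/
theorem ofReal_le_energy {E : Type*} [NormedAddCommGroup E] [InnerProductSpace ℂ E]
    {A : E →ₗ.[ℂ] E} {φ : E → ℝ} (hφ : Continuous φ)
    (h : ∀ g : A.domain, φ g ≤ (⟪(g : E), A g⟫_ℂ).re) (f : E) :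
    ENNReal.ofReal (φ f) ≤ energy A f := by
  rw [energy]
  rcases (comap (fun g : A.domain => (g : E)) (𝓝 f)).eq_or_neBot with hb | hb
  · rw [hb]; simp
  · have h1 : Tendsto (fun g : A.domain => ENNReal.ofReal (φ g))
        (comap (fun g : A.domain => (g : E)) (𝓝 f)) (𝓝 (ENNReal.ofReal (φ f))) :=
      (ENNReal.continuous_ofReal.comp hφ).continuousAt.tendsto.comp tendsto_comap
    rw [← h1.liminf_eq]
    exact liminf_le_liminf (Eventually.of_forall fun g => ENNReal.ofReal_le_ofReal (h g))

variable {E : Type*} [NormedAddCommGroup E] [InnerProductSpace ℂ E] [CompleteSpace E]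
  {A : E →ₗ.[ℂ] E}

theorem _root_.Submodule.starProjection_comm_of_invariant (K : Submodule ℂ E)
    [K.HasOrthogonalProjection] {T : E →L[ℂ] E} (hT : IsSelfAdjoint T)
    (hK : ∀ x ∈ K, T x ∈ K) (x : E) : K.starProjection (T x) = T (K.starProjection x) := by
  refine Submodule.eq_starProjection_of_mem_orthogonal
    (hK _ (Submodule.starProjection_apply_mem K x)) ?_
  rw [← map_sub, Submodule.mem_orthogonal]
  intro u hu
  have h : ⟪T u, x - K.starProjection x⟫_ℂ = ⟪u, T (x - K.starProjection x)⟫_ℂ :=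
    hT.isSymmetric u _
  rw [← h]
  exact (Submodule.mem_orthogonal _ _).mp (Submodule.sub_starProjection_mem_orthogonal x) _
    (hK u hu)

theorem resolventOp_mem_orthogonal_kernel (hA : IsPositiveSelfAdjoint A) {x : E}
    (hx : x ∈ (kernel A)ᗮ) : resolventOp A x ∈ (kernel A)ᗮ := by
  rw [Submodule.mem_orthogonal] at hx ⊢
  intro u hu
  rw [← inner_resolventOp_left hA, resolventOp_apply_eq_self hA hu]
  exact hx u hu

theorem resolventOp_mem_spectralSubspace (hA : IsPositiveSelfAdjoint A) (l : ℝ≥0) {x : E}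
    (hx : x ∈ spectralSubspace A l) : resolventOp A x ∈ spectralSubspace A l := by
  refine ⟨?_, resolventOp_mem_orthogonal_kernel hA hx.2⟩
  have h := congrArg (fun T : E →L[ℂ] E => T x) (commute_cutoff_resolventOp (A := A) l).eq
  have h0 : cutoff A l x = 0 := hx.1
  change cutoff A l (resolventOp A x) = resolventOp A (cutoff A l x) at h
  change cutoff A l (resolventOp A x) = 0
  rw [h, h0, map_zero]

theorem spectralProj_resolventOp (hA : IsPositiveSelfAdjoint A) (l : ℝ≥0) (x : E) :
    spectralProj A l (resolventOp A x) = resolventOp A (spectralProj A l x) :=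
  Submodule.starProjection_comm_of_invariant _ (isSelfAdjoint_resolventOp hA)
    (fun _ => resolventOp_mem_spectralSubspace hA l) x

theorem starProjection_orthogonal_kernel_resolventOp (hA : IsPositiveSelfAdjoint A) (x : E) :
    (kernel A)ᗮ.starProjection (resolventOp A x)
      = resolventOp A ((kernel A)ᗮ.starProjection x) :=
  Submodule.starProjection_comm_of_invariant _ (isSelfAdjoint_resolventOp hA)
    (fun _ => resolventOp_mem_orthogonal_kernel hA) x

theorem spectralProj_mem (l : ℝ≥0) (x : E) : spectralProj A l x ∈ spectralSubspace A l :=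
  Submodule.starProjection_apply_mem _ x

theorem spectralProj_apply_of_le {l m : ℝ≥0} (h : l ≤ m) (x : E) :
    spectralProj A l (spectralProj A m x) = spectralProj A l x := by
  have h1 := Submodule.starProjection_comp_starProjection_of_le (spectralSubspace_mono A h)
  exact congrArg (fun T : E →L[ℂ] E => T x) h1

theorem spectralProj_starProjection_orthogonal_kernel (l : ℝ≥0) (x : E) :
    spectralProj A l ((kernel A)ᗮ.starProjection x) = spectralProj A l x := by
  have h : spectralSubspace A l ≤ (kernel A)ᗮ := inf_le_right
  have h1 := Submodule.starProjection_comp_starProjection_of_le h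
  exact congrArg (fun T : E →L[ℂ] E => T x) h1

theorem norm_spectralProj_le (l : ℝ≥0) (x : E) : ‖spectralProj A l x‖ ≤ ‖x‖ :=
  Submodule.norm_starProjection_apply_le _ x

theorem inner_spectralProj_left (l : ℝ≥0) (x y : E) :
    ⟪spectralProj A l x, y⟫_ℂ = ⟪x, spectralProj A l y⟫_ℂ :=
  Submodule.inner_starProjection_left_eq_right _ x y

/-- At level `0` the cutoff is `1 - R`, whose kernel is `ker A`; nothing is left in the orthogonal
of `ker A`. This gives `F(0) = 0`. -/
theorem spectralProj_zero (hA : IsPositiveSelfAdjoint A) : spectralProj A 0 = 0 := by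
  have h : ∀ f ∈ spectralSubspace A 0, f = 0 := by
    intro f hf
    have h1 : cutoff A 0 = 1 - resolventOp A := by
      have hsa : IsSelfAdjoint (resolventOp A) := isSelfAdjoint_resolventOp hA
      have h2 : 1 - resolventOp A = cfc (fun x : ℝ => 1 - x) (resolventOp A) := by
        rw [cfc_sub _ _ _ (by fun_prop) (by fun_prop), cfc_const_one ℝ _, cfc_id' ℝ _]
      rw [h2, cutoff]
      refine cfc_congr fun x hx => ?_
      have hx1 : x ≤ 1 := by
        refine (le_algebraMap_iff_spectrum_le (R := ℝ) hsa).mp ?_ x hx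
        rw [map_one]
        exact resolventOp_le_one hA
      simp [hx1]
    have h3 : cutoff A 0 f = 0 := hf.1
    rw [h1] at h3
    have h4 : f - resolventOp A f = 0 := h3
    have h5 := mem_kernel_of_resolventOp_apply_eq_self hA (sub_eq_zero.mp h4).symm
    exact inner_self_eq_zero.mp ((Submodule.mem_orthogonal _ _).mp hf.2 f h5)
  ext x
  exact h _ (spectralProj_mem 0 x)

/-- The kernel of the cutoff is the orthogonal sum of its part in `(ker A)ᗮᗮ` and the spectral
subspace, and the vector is orthogonal to both. -/
theorem sub_spectralProj_mem_orthogonal (hA : IsPositiveSelfAdjoint A) (l : ℝ≥0) {x : E}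
    (hx : x ∈ (kernel A)ᗮ) :
    x - spectralProj A l x ∈ (LinearMap.ker (cutoff A l : E →ₗ[ℂ] E))ᗮ := by
  rw [Submodule.mem_orthogonal]
  intro s hs
  set C := (kernel A)ᗮ.starProjection
  have hclosed : IsClosed (LinearMap.ker (cutoff A l : E →ₗ[ℂ] E) : Set E) :=
    (cutoff A l).isClosed_ker
  have : CompleteSpace (LinearMap.ker (cutoff A l : E →ₗ[ℂ] E)) := hclosed.completeSpace_coe
  have h1 : s - C s ∈ (kernel A)ᗮᗮ := Submodule.sub_starProjection_mem_orthogonal s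
  have h2 : s - C s ∈ LinearMap.ker (cutoff A l : E →ₗ[ℂ] E) := by
    -- Closedness of the kernel of the cutoff makes the inclusion of `ker A` pass to its double
    -- orthogonal.
    rw [← Submodule.orthogonal_orthogonal (LinearMap.ker (cutoff A l : E →ₗ[ℂ] E))]
    exact Submodule.orthogonal_le (Submodule.orthogonal_le (kernel_le_ker_cutoff hA l)) h1
  have h3 : C s ∈ spectralSubspace A l := by
    refine ⟨?_, Submodule.starProjection_apply_mem _ s⟩
    have := sub_mem hs h2
    rwa [sub_sub_cancel] at this
  have h4 : x - spectralProj A l x ∈ (kernel A)ᗮ := sub_mem hx (spectralProj_mem l x).2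
  have h5 : ⟪s - C s, x - spectralProj A l x⟫_ℂ = 0 :=
    Submodule.inner_left_of_mem_orthogonal h4 h1
  have h6 : ⟪C s, x - spectralProj A l x⟫_ℂ = 0 :=
    (Submodule.mem_orthogonal _ _).mp (Submodule.sub_starProjection_mem_orthogonal x) _ h3
  rw [← sub_add_cancel s (C s), inner_add_left, h5, h6, add_zero]

/-- The resolvent commutes with the projection, so it is block diagonal for `K ⊕ Kᗮ` and the cross
terms vanish. -/
theorem re_inner_resolventOp_starProjection_add {E : Type*} [NormedAddCommGroup E]
    [InnerProductSpace ℂ E] {A : E →ₗ.[ℂ] E} (K : Submodule ℂ E) [K.HasOrthogonalProjection]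
    (hK : ∀ x, K.starProjection (resolventOp A x) = resolventOp A (K.starProjection x)) (w : E) :
    (⟪resolventOp A w, w - resolventOp A w⟫_ℂ).re =
      (⟪resolventOp A (w - K.starProjection w),
        (w - K.starProjection w) - resolventOp A (w - K.starProjection w)⟫_ℂ).re +
      (⟪resolventOp A (K.starProjection w),
        K.starProjection w - resolventOp A (K.starProjection w)⟫_ℂ).re := by
  set P := K.starProjection
  set a := w - P w
  set b := P w
  have hw : w = a + b := (sub_add_cancel w b).symm
  have hb : b - resolventOp A b ∈ K := by
    rw [← hK]
    exact sub_mem (Submodule.starProjection_apply_mem _ _) (Submodule.starProjection_apply_mem _ _)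
  have hb' : resolventOp A b ∈ K := by
    rw [← hK]
    exact Submodule.starProjection_apply_mem _ _
  have ha' : resolventOp A a ∈ Kᗮ := by
    rw [map_sub, ← hK]
    exact Submodule.sub_starProjection_mem_orthogonal _
  have ha : a - resolventOp A a ∈ Kᗮ :=
    sub_mem (Submodule.sub_starProjection_mem_orthogonal _) ha'
  have h1 : ⟪resolventOp A a, b - resolventOp A b⟫_ℂ = 0 :=
    Submodule.inner_left_of_mem_orthogonal hb ha'
  have h2 : ⟪resolventOp A b, a - resolventOp A a⟫_ℂ = 0 :=
    Submodule.inner_right_of_mem_orthogonal hb' ha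
  have h3 : w - resolventOp A w = (a - resolventOp A a) + (b - resolventOp A b) := by
    rw [hw, map_add]; abel
  have h4 : resolventOp A w = resolventOp A a + resolventOp A b := by
    conv_lhs => rw [hw, map_add]
  rw [h3, h4, inner_add_left, inner_add_right, inner_add_right, h1, h2,
    add_zero, zero_add, Complex.add_re]

/-- The energy of an element of the domain is bounded below by its spectral sums. -/
theorem spectral_sum_le_inner (hA : IsPositiveSelfAdjoint A) (u : ℕ → ℝ≥0) (hu : Antitone u)
    (N : ℕ) (h : A.domain) :
    u 0 * ‖(kernel A)ᗮ.starProjection (h : E) - spectralProj A (u 0) (h : E)‖ ^ 2 +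
      ∑ k ∈ Finset.range N, u (k + 1) *
        ‖spectralProj A (u k) (h : E) - spectralProj A (u (k + 1)) (h : E)‖ ^ 2 ≤
      (⟪(h : E), A h⟫_ℂ).re := by
  set R := resolventOp A
  set w : E := h + A h
  set C := (kernel A)ᗮ.starProjection
  have hRw : R w = h := resolventOp_add_apply hA h
  have hAh : A h = w - R w := by rw [hRw]; exact (add_sub_cancel_left _ _).symm
  rw [hAh, ← hRw]
  let q : E → ℝ := fun x => (⟪R x, x - R x⟫_ℂ).re
  have hq : ∀ x, 0 ≤ q x := re_inner_resolventOp_sub_nonneg hA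
  have hproj : ∀ (l : ℝ≥0) x, q x = q (x - spectralProj A l x) + q (spectralProj A l x) :=
    fun l x => re_inner_resolventOp_starProjection_add (spectralSubspace A l)
      (spectralProj_resolventOp hA l) x
  have hC : q w = q (w - C w) + q (C w) :=
    re_inner_resolventOp_starProjection_add _ (starProjection_orthogonal_kernel_resolventOp hA) w
  -- Each step of the induction peels off the shell `]u (k + 1), u k]`, where the form is at least
  -- `u (k + 1)` times the squared norm. The nonnegative remainder below `u N` is dropped at the
  -- end.
  have hsum : ∑ k ∈ Finset.range N, u (k + 1) *
      ‖spectralProj A (u k) (R w) - spectralProj A (u (k + 1)) (R w)‖ ^ 2 +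
      q (spectralProj A (u N) w) ≤ q (spectralProj A (u 0) w) := by
    induction N with
    | zero => simp
    | succ N ih =>
      rw [Finset.sum_range_succ]
      have h1 := hproj (u (N + 1)) (spectralProj A (u N) w)
      rw [spectralProj_apply_of_le (hu (Nat.le_succ N))] at h1
      have h2 : u (N + 1) * ‖R (spectralProj A (u N) w - spectralProj A (u (N + 1)) w)‖ ^ 2 ≤
          q (spectralProj A (u N) w - spectralProj A (u (N + 1)) w) := by
        refine mul_norm_sq_resolventOp_le hA _ ?_
        have h3 := sub_spectralProj_mem_orthogonal hA (u (N + 1))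
          (x := spectralProj A (u N) w) (spectralProj_mem _ w).2
        rwa [spectralProj_apply_of_le (hu (Nat.le_succ N))] at h3
      rw [map_sub, ← spectralProj_resolventOp hA, ← spectralProj_resolventOp hA] at h2
      linarith
  have htop : u 0 * ‖C (R w) - spectralProj A (u 0) (R w)‖ ^ 2 ≤
      q (C w - spectralProj A (u 0) w) := by
    rw [starProjection_orthogonal_kernel_resolventOp hA, spectralProj_resolventOp hA, ← map_sub]
    refine mul_norm_sq_resolventOp_le hA _ ?_
    have h3 := sub_spectralProj_mem_orthogonal hA (u 0)
      (x := C w) (Submodule.starProjection_apply_mem _ w)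
    rwa [spectralProj_starProjection_orthogonal_kernel] at h3
  have h4 := hproj (u 0) (C w)
  rw [spectralProj_starProjection_orthogonal_kernel] at h4
  have h5 := hq (w - C w)
  have h6 := hq (spectralProj A (u N) w)
  change _ ≤ q w
  linarith

theorem spectral_sum_le_energy (hA : IsPositiveSelfAdjoint A) (u : ℕ → ℝ≥0) (hu : Antitone u)
    (N : ℕ) {f : E} (hf : f ∈ (kernel A)ᗮ) :
    ENNReal.ofReal (u 0 * ‖f - spectralProj A (u 0) f‖ ^ 2 +
      ∑ k ∈ Finset.range N, u (k + 1) *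
        ‖spectralProj A (u k) f - spectralProj A (u (k + 1)) f‖ ^ 2) ≤ energy A f := by
  have h := ofReal_le_energy (A := A) (φ := fun f : E =>
    u 0 * ‖(kernel A)ᗮ.starProjection f - spectralProj A (u 0) f‖ ^ 2 +
      ∑ k ∈ Finset.range N, u (k + 1) *
        ‖spectralProj A (u k) f - spectralProj A (u (k + 1)) f‖ ^ 2) (by fun_prop)
    (spectral_sum_le_inner hA u hu N) f
  rwa [Submodule.starProjection_eq_self_iff.mpr hf] at h

theorem mul_norm_sq_sub_spectralProj_le_energy (hA : IsPositiveSelfAdjoint A) (l : ℝ≥0) {f : E}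
    (hf : f ∈ (kernel A)ᗮ) :
    l * ENNReal.ofReal (‖f - spectralProj A l f‖ ^ 2) ≤ energy A f := by
  have h := spectral_sum_le_energy hA (fun _ => l) antitone_const 0 hf
  rw [Finset.sum_range_zero, add_zero, ENNReal.ofReal_mul (NNReal.coe_nonneg l), ENNReal.ofReal_coe_nnreal] at h
  exact h

/-- For `g` in the domain, the part of `g` above `l` has squared norm at most `⟨g, A g⟩ / l`. The
general case follows by density of the domain and contractivity of the projections. -/
theorem tendsto_spectralProj_atTop (hA : IsPositiveSelfAdjoint A) {f : E}
    (hf : f ∈ (kernel A)ᗮ) : Tendsto (fun l => spectralProj A l f) atTop (𝓝 f) := by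
  rw [Metric.tendsto_atTop]
  intro ε hε
  obtain ⟨g, hg, hfg⟩ := Metric.dense_iff.mp hA.selfAdjoint.dense_domain f (ε / 3) (by positivity)
  set C := (kernel A)ᗮ.starProjection
  obtain ⟨L, hL⟩ := exists_nat_gt ((⟪g, A ⟨g, hfg⟩⟫_ℂ).re / (ε / 3) ^ 2)
  refine ⟨L, fun l hl => ?_⟩
  have h1 := spectral_sum_le_inner hA (fun _ => l) antitone_const 0 ⟨g, hfg⟩
  simp only [Finset.sum_range_zero, add_zero] at h1
  rw [div_lt_iff₀ (by positivity)] at hL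
  have hl' : (L : ℝ) ≤ l := by exact_mod_cast hl
  have h2 : ‖C g - spectralProj A l g‖ < ε / 3 := by
    by_contra! hcon
    have h3 : (ε / 3) ^ 2 ≤ ‖C g - spectralProj A l g‖ ^ 2 := by gcongr
    have h4 : L * (ε / 3) ^ 2 ≤ l * ‖C g - spectralProj A l g‖ ^ 2 := by gcongr
    exact absurd h1 (not_le.mpr (hL.trans_le h4))
  have hdist : ‖g - f‖ < ε / 3 := by rwa [← dist_eq_norm]
  have h5 : C f = f := Submodule.starProjection_eq_self_iff.mpr hf
  have h6 : spectralProj A l f - f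
      = spectralProj A l (f - g) - (C g - spectralProj A l g) + C (g - f) := by
    rw [map_sub, map_sub, h5]; abel
  have h7 : ‖C (g - f)‖ ≤ ‖g - f‖ := Submodule.norm_starProjection_apply_le _ _
  have h8 := norm_spectralProj_le (A := A) l (f - g)
  rw [norm_sub_rev f g] at h8
  rw [dist_eq_norm, h6]
  have h9 := norm_add_le (spectralProj A l (f - g) - (C g - spectralProj A l g)) (C (g - f))
  have h10 := norm_sub_le (spectralProj A l (f - g)) (C g - spectralProj A l g)
  linarith

end SpectralDecomposition

/-! ### Hilbert-Schmidt norms, traces and square roots -/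

section HilbertSchmidt

theorem _root_.HilbertBasis.tsum_ofReal_norm_sq_inner {ι E : Type*}
    [NormedAddCommGroup E] [InnerProductSpace ℂ E] (b : HilbertBasis ι ℂ E) (x : E) :
    ∑' i, ENNReal.ofReal (‖⟪b i, x⟫_ℂ‖ ^ 2) = ENNReal.ofReal (‖x‖ ^ 2) := by
  have h := b.hasSum_inner_mul_inner x x
  have h1 : HasSum (fun i => ‖⟪b i, x⟫_ℂ‖ ^ 2) (‖x‖ ^ 2) := by
    have h2 := Complex.hasSum_re h
    have h3 : (⟪x, x⟫_ℂ).re = ‖x‖ ^ 2 := inner_self_eq_norm_sq (𝕜 := ℂ) _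
    rw [h3] at h2
    convert h2 using 2 with i
    rw [← inner_conj_symm x, ← Complex.normSq_eq_conj_mul_self, Complex.ofReal_re,
      Complex.normSq_eq_norm_sq]
  rw [← ENNReal.ofReal_tsum_of_nonneg (fun i => by positivity) h1.summable, h1.tsum_eq]

variable {E : Type*} [NormedAddCommGroup E] [InnerProductSpace ℂ E] [CompleteSpace E]

/-- The square of the Hilbert-Schmidt norm, in `[0, ∞]`. -/
noncomputable def hsSq (T : E →L[ℂ] E) : ℝ≥0∞ :=
  ∑' i, ENNReal.ofReal (‖T (basis E i)‖ ^ 2)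

/-- Both sides are the double sum of the squared matrix coefficients. -/
theorem hsSq_adjoint (T : E →L[ℂ] E) : hsSq (ContinuousLinearMap.adjoint T) = hsSq T := by
  have h : ∀ S : E →L[ℂ] E, hsSq S =
      ∑' i, ∑' j, ENNReal.ofReal (‖⟪basis E j, S (basis E i)⟫_ℂ‖ ^ 2) := fun S => by
    refine tsum_congr fun i => ?_
    rw [HilbertBasis.tsum_ofReal_norm_sq_inner]
  rw [h, h, ENNReal.tsum_comm]
  refine tsum_congr fun i => tsum_congr fun j => ?_
  rw [ContinuousLinearMap.adjoint_inner_right, norm_inner_symm]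

theorem ofReal_norm_sq_apply_le_hsSq (T : E →L[ℂ] E) (w : E) :
    ENNReal.ofReal (‖T w‖ ^ 2) ≤ ENNReal.ofReal (‖w‖ ^ 2) * hsSq T := by
  rw [← hsSq_adjoint, hsSq, ← ENNReal.tsum_mul_left,
    ← (basis E).tsum_ofReal_norm_sq_inner]
  refine ENNReal.tsum_le_tsum fun i => ?_
  rw [← ENNReal.ofReal_mul (by positivity), ← ContinuousLinearMap.adjoint_inner_left, ← mul_pow]
  refine ENNReal.ofReal_le_ofReal ?_
  gcongr
  rw [mul_comm]
  exact norm_inner_le_norm _ _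

theorem trace_adjoint_comp_self (T : E →L[ℂ] E) :
    trace (ContinuousLinearMap.adjoint T ∘L T) = hsSq T := by
  refine tsum_congr fun i => ?_
  rw [ContinuousLinearMap.comp_apply, ContinuousLinearMap.adjoint_inner_right]
  congr 1
  exact inner_self_eq_norm_sq (𝕜 := ℂ) _

/-- The positive square root of a bounded positive operator. -/
noncomputable def sqrtOp (ρ : E →L[ℂ] E) : E →L[ℂ] E := CFC.sqrt ρ

theorem stateEnergy_eq_tsum (A : E →ₗ.[ℂ] E) (ρ : E →L[ℂ] E) :
    stateEnergy A ρ = ∑' i, energy A (sqrtOp ρ (basis E i)) := rfl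

theorem energy_sqrtOp_le_stateNorm (A : E →ₗ.[ℂ] E) (ρ : E →L[ℂ] E) {f : E} (hf : ‖f‖ ≤ 1) :
    energy A (sqrtOp ρ f) ≤ stateNorm A ρ :=
  le_iSup₂ (f := fun (f : E) (_ : ‖f‖ ≤ 1) => energy A (sqrtOp ρ f)) f hf

theorem stateNorm_le {A : E →ₗ.[ℂ] E} {ρ : E →L[ℂ] E} {c : ℝ≥0∞}
    (h : ∀ f, ‖f‖ ≤ 1 → energy A (sqrtOp ρ f) ≤ c) : stateNorm A ρ ≤ c :=
  iSup₂_le h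

theorem sqrtOp_starProjection (W : Submodule ℂ E) [W.HasOrthogonalProjection] :
    sqrtOp W.starProjection = W.starProjection :=
  CFC.sqrt_unique W.isIdempotentElem_starProjection
    ((ContinuousLinearMap.nonneg_iff_isPositive _).mpr
      (ContinuousLinearMap.IsPositive.of_isStarProjection isStarProjection_starProjection))

theorem sqrtOp_mul_sqrtOp {ρ : E →L[ℂ] E} (hρ : ρ.IsPositive) :
    sqrtOp ρ * sqrtOp ρ = ρ :=
  CFC.sqrt_mul_sqrt_self _ ((ContinuousLinearMap.nonneg_iff_isPositive _).mpr hρ)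

theorem isSelfAdjoint_sqrtOp (ρ : E →L[ℂ] E) : IsSelfAdjoint (sqrtOp ρ) :=
  IsSelfAdjoint.of_nonneg (CFC.sqrt_nonneg ρ)

theorem inner_sqrtOp_left (ρ : E →L[ℂ] E) (x y : E) :
    ⟪sqrtOp ρ x, y⟫_ℂ = ⟪x, sqrtOp ρ y⟫_ℂ :=
  (isSelfAdjoint_sqrtOp ρ).isSymmetric x y

theorem trace_eq_hsSq_sqrtOp {ρ : E →L[ℂ] E} (hρ : ρ.IsPositive) :
    trace ρ = hsSq (sqrtOp ρ) := by
  rw [← trace_adjoint_comp_self, (isSelfAdjoint_sqrtOp ρ).adjoint_eq]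
  exact congrArg trace (sqrtOp_mul_sqrtOp hρ).symm

theorem sqrtOp_apply_eq_zero {ρ : E →L[ℂ] E} (hρ : ρ.IsPositive) {x : E} (hx : ρ x = 0) :
    sqrtOp ρ x = 0 := by
  rw [← inner_self_eq_zero (𝕜 := ℂ), inner_sqrtOp_left, ← mul_apply_eq_comp,
    sqrtOp_mul_sqrtOp hρ, hx, inner_zero_right]

/-- Expand `‖W.starProjection e_i‖²` in an orthonormal basis `b_j` of `W` and sum over `i` first:
each `j` contributes `‖b_j‖² = 1`. -/
theorem trace_starProjection (W : Submodule ℂ E) [FiniteDimensional ℂ W] :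
    trace W.starProjection = (Module.finrank ℂ W : ℝ≥0∞) := by
  have h1 : trace W.starProjection = hsSq W.starProjection := by
    rw [← trace_adjoint_comp_self, (isSelfAdjoint_starProjection W).adjoint_eq]
    exact congrArg trace W.isIdempotentElem_starProjection.symm
  let b := stdOrthonormalBasis ℂ W
  have h2 : ∀ x : E, ENNReal.ofReal (‖W.starProjection x‖ ^ 2) =
      ∑ j, ENNReal.ofReal (‖⟪x, (b j : E)⟫_ℂ‖ ^ 2) := by
    intro x
    rw [← ENNReal.ofReal_sum_of_nonneg (fun _ _ => by positivity)]
    congr 1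
    rw [Submodule.starProjection_apply, Submodule.norm_coe, ← b.sum_sq_norm_inner_right]
    refine Finset.sum_congr rfl fun j _ => ?_
    rw [Submodule.inner_orthogonalProjectionOnto_eq_of_mem_left, norm_inner_symm]
  rw [h1, hsSq]
  simp_rw [h2]
  rw [Summable.tsum_finsetSum (fun _ _ => ENNReal.summable)]
  simp_rw [HilbertBasis.tsum_ofReal_norm_sq_inner]
  have h3 : ∀ j, ‖(b j : E)‖ = 1 := fun j => b.orthonormal.1 j
  simp [h3]

end HilbertSchmidt

/-! ### Dyadic Cauchy-Schwarz inequality -/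

section CauchySchwarz

variable {E : Type*} [NormedAddCommGroup E] [InnerProductSpace ℂ E] [CompleteSpace E]
  {A : E →ₗ.[ℂ] E}

/-- A dyadic upper bound of `⟨A⁻¹ Π_l g, g⟩`. -/
noncomputable def dyadicForm (A : E →ₗ.[ℂ] E) (l : ℝ≥0) (g : E) : ℝ≥0∞ :=
  2 / l * (ENNReal.ofReal (‖spectralProj A l g‖ ^ 2) +
    ∑' k : ℕ, 2 ^ k * ENNReal.ofReal (‖spectralProj A (l / 2 ^ (k + 1)) g‖ ^ 2))

theorem norm_sq_spectralProj_sub {l m : ℝ≥0} (h : l ≤ m) (g : E) :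
    ‖spectralProj A m g - spectralProj A l g‖ ^ 2 =
      ‖spectralProj A m g‖ ^ 2 - ‖spectralProj A l g‖ ^ 2 := by
  have h1 : ⟪spectralProj A l g, spectralProj A m g - spectralProj A l g⟫_ℂ = 0 := by
    rw [inner_spectralProj_left, map_sub, spectralProj_apply_of_le h,
      spectralProj_apply_of_le le_rfl, sub_self, inner_zero_right]
  have h2 := norm_add_sq_eq_norm_sq_add_norm_sq_of_inner_eq_zero _ _ h1
  rw [add_sub_cancel] at h2
  rw [sq, sq, sq, h2]
  ring

theorem inner_spectralProj_sub {l m : ℝ≥0} (h : l ≤ m) (f g : E) :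
    ⟪f, spectralProj A m g - spectralProj A l g⟫_ℂ =
      ⟪spectralProj A m f - spectralProj A l f, spectralProj A m g - spectralProj A l g⟫_ℂ := by
  have h1 : spectralProj A m (spectralProj A l g) = spectralProj A l g :=
    Submodule.starProjection_eq_self_iff.mpr (spectralSubspace_mono A h (spectralProj_mem l g))
  rw [inner_sub_left, inner_spectralProj_left, inner_spectralProj_left, map_sub, map_sub, h1,
    spectralProj_apply_of_le h, spectralProj_apply_of_le le_rfl, spectralProj_apply_of_le le_rfl,
    sub_self, inner_zero_right, sub_zero]

/-- Abel summation, to pass from spectral shells to the projections `Π_{l / 2^(k+1)}`. -/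
theorem sum_sub_mul_two_pow (p : ℕ → ℝ) (N : ℕ) :
    ∑ k ∈ Finset.range N, (p k - p (k + 1)) * 2 ^ k + p N * 2 ^ N =
      p 0 + ∑ k ∈ Finset.range N, 2 ^ k * p (k + 1) := by
  induction N with
  | zero => simp
  | succ N ih =>
    rw [Finset.sum_range_succ, Finset.sum_range_succ, ← add_assoc, ← ih]
    ring

theorem dyadic_antitone (l : ℝ≥0) : Antitone fun k : ℕ => l / 2 ^ k := by
  intro j k h
  dsimp only
  gcongr
  exact one_le_two

/-- Cauchy-Schwarz on each shell, then over the shells with weights `u (k + 1)` and `1 / u (k + 1)`.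
The first sum is a spectral lower bound of `𝓔(h)`, the second a truncation of `⟨A⁻¹ Π_l g, g⟩` with
the weight rounded up. -/
theorem ofReal_norm_sq_inner_sub_le (hA : IsPositiveSelfAdjoint A) {l : ℝ≥0} (hl : l ≠ 0)
    {h : E} (hh : h ∈ (kernel A)ᗮ) (g : E) (N : ℕ) :
    ENNReal.ofReal (‖⟪h, spectralProj A l g - spectralProj A (l / 2 ^ N) g⟫_ℂ‖ ^ 2) ≤
      energy A h * dyadicForm A l g := by
  have hl' : (0 : ℝ) < l := NNReal.coe_pos.mpr (pos_iff_ne_zero.mpr hl)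
  set u : ℕ → ℝ≥0 := fun k => l / 2 ^ k with hu_def
  have hu : Antitone u := dyadic_antitone l
  have hu0 : u 0 = l := by simp [hu_def]
  have hupos : ∀ k, (0 : ℝ) < u k := fun k => by simp only [hu_def]; push_cast; positivity
  set a : ℕ → E := fun k => spectralProj A (u k) h - spectralProj A (u (k + 1)) h
  set b : ℕ → E := fun k => spectralProj A (u k) g - spectralProj A (u (k + 1)) g
  set S : ℝ := ∑ k ∈ Finset.range N, u (k + 1) * ‖a k‖ ^ 2
  set T : ℝ := ∑ k ∈ Finset.range N, (u (k + 1) : ℝ)⁻¹ * ‖b k‖ ^ 2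
  have hS0 : 0 ≤ S := Finset.sum_nonneg fun k _ => by positivity
  have h1 : ‖⟪h, spectralProj A l g - spectralProj A (u N) g⟫_ℂ‖ ≤
      ∑ k ∈ Finset.range N, ‖a k‖ * ‖b k‖ := by
    have h2 : spectralProj A l g - spectralProj A (u N) g = ∑ k ∈ Finset.range N, b k := by
      rw [Finset.sum_range_sub' (fun k => spectralProj A (u k) g), hu0]
    rw [h2, inner_sum]
    refine (norm_sum_le _ _).trans (Finset.sum_le_sum fun k _ => ?_)
    rw [inner_spectralProj_sub (hu (Nat.le_succ k))]
    exact norm_inner_le_norm _ _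
  have h2 : (∑ k ∈ Finset.range N, ‖a k‖ * ‖b k‖) ^ 2 ≤ S * T := by
    refine Finset.sum_sq_le_sum_mul_sum_of_sq_le_mul _ (fun k _ => by positivity)
      (fun k _ => by positivity) fun k _ => ?_
    have := (hupos (k + 1)).ne'
    refine le_of_eq ?_
    field_simp
  have hS : ENNReal.ofReal S ≤ energy A h := by
    refine le_trans (ENNReal.ofReal_le_ofReal ?_) (spectral_sum_le_energy hA u hu N hh)
    exact le_add_of_nonneg_left (by positivity)
  -- Since `1 / u (k + 1) = (2 / l) * 2 ^ k` and the squared norms of the shells are differences,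
  -- Abel summation applies; its boundary term is nonnegative and is dropped.
  have hT : T ≤ 2 / l * (‖spectralProj A l g‖ ^ 2 +
      ∑ k ∈ Finset.range N, 2 ^ k * ‖spectralProj A (l / 2 ^ (k + 1)) g‖ ^ 2) := by
    have h3 := sum_sub_mul_two_pow (fun k => ‖spectralProj A (u k) g‖ ^ 2) N
    simp only [hu0] at h3
    rw [← h3, mul_add]
    refine le_add_of_le_of_nonneg (le_of_eq ?_) (by positivity)
    rw [Finset.mul_sum]
    refine Finset.sum_congr rfl fun k _ => ?_
    rw [norm_sq_spectralProj_sub (hu (Nat.le_succ k))]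
    simp only [hu_def]
    push_cast
    rw [pow_succ]
    field_simp
  have hT' : ENNReal.ofReal T ≤ dyadicForm A l g := by
    refine (ENNReal.ofReal_le_ofReal hT).trans ?_
    rw [ENNReal.ofReal_mul (by positivity), dyadicForm, ENNReal.ofReal_div_of_pos hl',
      ENNReal.ofReal_add (by positivity) (Finset.sum_nonneg fun _ _ => by positivity),
      ENNReal.ofReal_sum_of_nonneg (fun _ _ => by positivity), ENNReal.ofReal_coe_nnreal,
      ENNReal.ofReal_ofNat]
    gcongr
    refine le_trans (Finset.sum_le_sum fun k _ => ?_) (ENNReal.sum_le_tsum (Finset.range N))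
    rw [ENNReal.ofReal_mul (by positivity), ENNReal.ofReal_pow (by positivity),
      ENNReal.ofReal_ofNat]
  calc ENNReal.ofReal (‖⟪h, spectralProj A l g - spectralProj A (u N) g⟫_ℂ‖ ^ 2)
      ≤ ENNReal.ofReal (S * T) := by
        refine ENNReal.ofReal_le_ofReal (le_trans ?_ h2)
        gcongr
    _ = ENNReal.ofReal S * ENNReal.ofReal T := ENNReal.ofReal_mul hS0
    _ ≤ _ := mul_le_mul' hS hT'

theorem ofReal_norm_sq_inner_spectralProj_le (hA : IsPositiveSelfAdjoint A) {l : ℝ≥0}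
    (hl : l ≠ 0) {h : E} (hh : h ∈ (kernel A)ᗮ) {g : E}
    (hg : Tendsto (fun N : ℕ => spectralProj A (l / 2 ^ N) g) atTop (𝓝 0)) :
    ENNReal.ofReal (‖⟪h, spectralProj A l g⟫_ℂ‖ ^ 2) ≤ energy A h * dyadicForm A l g := by
  have h1 : Tendsto (fun N : ℕ => ENNReal.ofReal
      (‖⟪h, spectralProj A l g - spectralProj A (l / 2 ^ N) g⟫_ℂ‖ ^ 2)) atTop
      (𝓝 (ENNReal.ofReal (‖⟪h, spectralProj A l g - 0⟫_ℂ‖ ^ 2))) :=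
    ENNReal.tendsto_ofReal
      (((tendsto_const_nhds.inner (tendsto_const_nhds.sub hg)).norm).pow 2)
  rw [sub_zero] at h1
  exact le_of_tendsto h1 (Eventually.of_forall fun N => ofReal_norm_sq_inner_sub_le hA hl hh g N)

end CauchySchwarz

/-! ### Dyadic sums and the Stieltjes integral -/

section Stieltjes

variable {F : ℝ≥0 → ℝ≥0∞} (hF : Monotone F) (hfin : ∀ l, F l ≠ ∞)

/-- The stopped function vanishes left of `0`, so its left limit there does too. At `s` the measure
sees the right limit, whence an inequality when `F` is not right continuous. -/
theorem le_stieltjes_measure_Icc (h0 : F 0 = 0) {s l : ℝ≥0} (hs : s ≤ l) :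
    F s ≤ (stopped_mono hF hfin l).stieltjesFunction.measure (Set.Icc (0 : ℝ) s) := by
  set f := (stopped_mono hF hfin l).stieltjesFunction with hf
  have h1 : Function.leftLim f 0 ≤ 0 := by
    refine le_of_tendsto (f.mono.tendsto_leftLim 0) ?_
    filter_upwards [self_mem_nhdsWithin] with x hx
    rw [hf, Monotone.stieltjesFunction_eq]
    refine ((stopped_mono hF hfin l).rightLim_le hx).trans (le_of_eq ?_)
    simp [stopped, h0]
  have h2 : (F s).toReal ≤ f s := by
    rw [hf, Monotone.stieltjesFunction_eq]
    refine le_trans (le_of_eq ?_) ((stopped_mono hF hfin l).le_rightLim le_rfl)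
    simp [stopped, hs]
  rw [StieltjesFunction.measure_Icc, ← ENNReal.ofReal_toReal (hfin s)]
  exact ENNReal.ofReal_le_ofReal (by linarith)

/-- If `l / 2^(j+1) < x ≤ l / 2^j`, the left side is at most `1 + (1 + 2 + ⋯ + 2^(j-1)) = 2^j ≤ l /
x`. For `x ≤ 0` the right side is `∞`. -/
theorem one_add_sum_indicator_le {l : ℝ≥0} (hl : l ≠ 0) {x : ℝ} (hx : x ≤ l) (N : ℕ) :
    1 + ∑ k ∈ Finset.range N, (Set.Iic ((l : ℝ) / 2 ^ (k + 1))).indicator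
      (fun _ => (2 : ℝ≥0∞) ^ k) x ≤ l * (ENNReal.ofReal x)⁻¹ := by
  have hl' : (0 : ℝ) < l := NNReal.coe_pos.mpr (pos_iff_ne_zero.mpr hl)
  have hbound : ∀ N : ℕ, 1 + ∑ k ∈ Finset.range N, (Set.Iic ((l : ℝ) / 2 ^ (k + 1))).indicator
      (fun _ => (2 : ℝ≥0∞) ^ k) x ≤ 2 ^ N := by
    intro N
    induction N with
    | zero => simp
    | succ N ih =>
      rw [Finset.sum_range_succ, ← add_assoc]
      calc _ ≤ (2 : ℝ≥0∞) ^ N + 2 ^ N :=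
            add_le_add ih (Set.indicator_le_self _ (fun _ : ℝ => (2 : ℝ≥0∞) ^ N) x)
        _ = 2 ^ (N + 1) := by rw [pow_succ, mul_two]
  have hle : ∀ N : ℕ, x ≤ l / 2 ^ N → (2 : ℝ≥0∞) ^ N ≤ l * (ENNReal.ofReal x)⁻¹ := by
    intro N hN
    rw [← div_eq_mul_inv, ENNReal.le_div_iff_mul_le (Or.inr (by simpa using hl)) (Or.inr (by simp))]
    rw [le_div_iff₀ (by positivity)] at hN
    calc (2 : ℝ≥0∞) ^ N * ENNReal.ofReal x = ENNReal.ofReal (x * 2 ^ N) := by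
          rw [ENNReal.ofReal_mul' (by positivity), ENNReal.ofReal_pow (by positivity),
            ENNReal.ofReal_ofNat, mul_comm]
      _ ≤ ENNReal.ofReal l := ENNReal.ofReal_le_ofReal hN
      _ = l := ENNReal.ofReal_coe_nnreal
  induction N with
  | zero => simpa using hle 0 (by simpa using hx)
  | succ N ih =>
    by_cases hN : x ≤ l / 2 ^ (N + 1)
    · exact (hbound (N + 1)).trans (hle (N + 1) hN)
    · rwa [Finset.sum_range_succ, Set.indicator_of_notMem (by simpa using hN), add_zero]

theorem add_tsum_le_mul_stieltjes (h0 : F 0 = 0) {l : ℝ≥0} (hl : l ≠ 0) :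
    F l + ∑' k : ℕ, 2 ^ k * F (l / 2 ^ (k + 1)) ≤ l * stieltjes F hF hfin l := by
  rw [ENNReal.tsum_eq_iSup_nat, ENNReal.add_iSup]
  refine iSup_le fun N => ?_
  set m := (stopped_mono hF hfin l).stieltjesFunction.measure with hm
  have hmeas : Measurable fun x : ℝ => (ENNReal.ofReal x)⁻¹ := by fun_prop
  calc F l + ∑ k ∈ Finset.range N, 2 ^ k * F (l / 2 ^ (k + 1))
      ≤ m (Set.Icc (0 : ℝ) l) +
        ∑ k ∈ Finset.range N, 2 ^ k * m (Set.Icc (0 : ℝ) (l / 2 ^ (k + 1))) := by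
        refine add_le_add (le_stieltjes_measure_Icc hF hfin h0 le_rfl)
          (Finset.sum_le_sum fun k _ => ?_)
        gcongr
        have h1 := le_stieltjes_measure_Icc hF hfin h0
          (show l / 2 ^ (k + 1) ≤ l by simpa using dyadic_antitone l (Nat.zero_le (k + 1)))
        push_cast at h1
        exact h1
    _ = ∫⁻ x in Set.Icc (0 : ℝ) l, (1 + ∑ k ∈ Finset.range N,
          (Set.Iic ((l : ℝ) / 2 ^ (k + 1))).indicator (fun _ => (2 : ℝ≥0∞) ^ k) x) ∂m := by
        rw [lintegral_add_left measurable_const, setLIntegral_one,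
          lintegral_finsetSum _ fun k _ => measurable_const.indicator measurableSet_Iic]
        congr 1
        refine Finset.sum_congr rfl fun k _ => ?_
        rw [lintegral_indicator measurableSet_Iic, setLIntegral_const,
          Measure.restrict_apply measurableSet_Iic]
        congr 2
        ext x
        simp only [Set.mem_Icc, Set.mem_inter_iff, Set.mem_Iic]
        have : (l : ℝ) / 2 ^ (k + 1) ≤ l :=
          div_le_self l.2 (one_le_pow₀ one_le_two)
        exact ⟨fun h => ⟨h.2, h.1, h.2.trans this⟩, fun h => ⟨h.2.1, h.1⟩⟩
    _ ≤ ∫⁻ x in Set.Icc (0 : ℝ) l, l * (ENNReal.ofReal x)⁻¹ ∂m :=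
        setLIntegral_mono (hmeas.const_mul _)
          fun x hx => one_add_sum_indicator_le hl hx.2 N
    _ = l * stieltjes F hF hfin l := by
        rw [lintegral_const_mul _ hmeas, stieltjes]

theorem le_mul_stieltjes (h0 : F 0 = 0) (l : ℝ≥0) : F l ≤ l * stieltjes F hF hfin l := by
  rcases eq_or_ne l 0 with rfl | hl
  · simp [h0]
  · exact le_self_add.trans (add_tsum_le_mul_stieltjes hF hfin h0 hl)

theorem stieltjes_le_stieltjesExt {l : ℝ≥0} {t : ℝ≥0∞} (h : (l : ℝ≥0∞) ≤ t) :
    stieltjes F hF hfin l ≤ stieltjesExt F hF hfin t :=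
  le_iSup₂_of_le l h le_rfl

/-- The supremum over levels gives monotonicity without comparing measures stopped at different
levels. -/
theorem stieltjesExt_mono : Monotone (stieltjesExt F hF hfin) := fun _ _ h =>
  iSup₂_le fun _ hs => stieltjes_le_stieltjesExt hF hfin (hs.trans h)

end Stieltjes

/-! ### Multiplication by indicator functions -/

section Indicator

variable {X : Type*} [MeasurableSpace X] {μ : Measure X}
  {H : Type*} [NormedAddCommGroup H] [InnerProductSpace ℂ H] {Ω : Set X}

theorem norm_indicatorOp_apply_le (hΩ : MeasurableSet Ω) (f : Lp H 2 μ) :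
    ‖indicatorOp μ H hΩ f‖ ≤ ‖f‖ := by
  refine Lp.norm_le_norm_of_ae_le ?_
  filter_upwards [coeFn_indicatorOp hΩ f] with x hx
  rw [hx]
  exact norm_indicator_le_norm_self _ _

theorem indicatorOp_apply_of_supportedIn (hΩ : MeasurableSet Ω) {f : Lp H 2 μ}
    (hf : SupportedIn Ω f) : indicatorOp μ H hΩ f = f := by
  refine Lp.ext ?_
  filter_upwards [coeFn_indicatorOp hΩ f, hf] with x hx hfx
  rw [hx]
  by_cases h : x ∈ Ω
  · rw [Set.indicator_of_mem h]
  · rw [Set.indicator_of_notMem h, hfx h]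

end Indicator

/-! ### Localised spectral projections and the trace bound -/

section Bounds

variable {X : Type*} [MeasurableSpace X] {μ : Measure X}
  {H : Type*} [NormedAddCommGroup H] [InnerProductSpace ℂ H] [CompleteSpace H]
  {A : Lp H 2 μ →ₗ.[ℂ] Lp H 2 μ} {Ω : Set X}

theorem adjoint_indicatorOp (hΩ : MeasurableSet Ω) :
    ContinuousLinearMap.adjoint (indicatorOp μ H hΩ) = indicatorOp μ H hΩ :=
  ((ContinuousLinearMap.eq_adjoint_iff _ _).mpr fun f g => inner_indicatorOp hΩ f g).symm

theorem adjoint_spectralProj (l : ℝ≥0) :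
    ContinuousLinearMap.adjoint (spectralProj A l) = spectralProj A l :=
  (isSelfAdjoint_starProjection (spectralSubspace A l)).adjoint_eq

theorem nu_spectralProj (hΩ : MeasurableSet Ω) (l : ℝ≥0) :
    nu (spectralProj A l) hΩ = hsSq (spectralProj A l ∘L indicatorOp μ H hΩ) := by
  rw [← trace_adjoint_comp_self, ContinuousLinearMap.adjoint_comp, adjoint_spectralProj,
    adjoint_indicatorOp, nu]
  congr 1
  ext1 f
  simp only [ContinuousLinearMap.comp_apply]
  rw [spectralProj_apply_of_le le_rfl]

theorem hsSq_spectralProj_indicatorOp_le (hF : ∀ l : ℝ≥0, spectralDensity A l ≠ ∞)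
    (hΩ : MeasurableSet Ω) (hμΩ : μ Ω ≠ ∞) (l : ℝ≥0) :
    hsSq (spectralProj A l ∘L indicatorOp μ H hΩ) ≤ μ Ω * spectralDensity A l := by
  rw [← nu_spectralProj, mul_comm]
  have h : nu (spectralProj A l) hΩ / μ Ω ≤ spectralDensity A l :=
    le_iSup₂ (f := fun (Ω : Set X) (hΩ : MeasurableSet Ω) => nu (spectralProj A l) hΩ / μ Ω) Ω hΩ
  -- If `μ Ω = 0`, a nonzero numerator would make the quotient infinite, against the finiteness of
  -- `F`.
  exact (ENNReal.div_le_iff_le_mul (Or.inr (hF l)) (Or.inl hμΩ)).mp h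

theorem spectralDensity_zero (hA : IsPositiveSelfAdjoint A) : spectralDensity A 0 = 0 := by
  rw [spectralDensity, spectralProj_zero hA, density]
  simp [nu, trace]

/-- The dyadic form of the localised spectral projections is controlled by the Stieltjes
integral. -/
theorem dyadic_hsSq_le (hA : IsPositiveSelfAdjoint A) (hF : ∀ l : ℝ≥0, spectralDensity A l ≠ ∞)
    (hΩ : MeasurableSet Ω) (hμΩ : μ Ω ≠ ∞) {l : ℝ≥0} (hl : l ≠ 0) :
    2 / l * (hsSq (spectralProj A l ∘L indicatorOp μ H hΩ) +
      ∑' k : ℕ, 2 ^ k * hsSq (spectralProj A (l / 2 ^ (k + 1)) ∘L indicatorOp μ H hΩ)) ≤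
    2 * μ Ω * stieltjesExt (spectralDensity A) (spectralDensity_mono A) hF l := by
  calc _ ≤ 2 / l * (μ Ω * spectralDensity A l +
        ∑' k : ℕ, μ Ω * (2 ^ k * spectralDensity A (l / 2 ^ (k + 1)))) := by
        refine mul_le_mul_right (add_le_add (hsSq_spectralProj_indicatorOp_le hF hΩ hμΩ l)
          (ENNReal.tsum_le_tsum fun k => ?_)) _
        rw [mul_left_comm]
        exact mul_le_mul_right (hsSq_spectralProj_indicatorOp_le hF hΩ hμΩ _) _
    _ = 2 / l * (μ Ω * (spectralDensity A l +
        ∑' k : ℕ, 2 ^ k * spectralDensity A (l / 2 ^ (k + 1)))) := by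
        rw [ENNReal.tsum_mul_left, ← mul_add]
    _ ≤ 2 / l * (μ Ω *
        (l * stieltjes (spectralDensity A) (spectralDensity_mono A) hF l)) := by
        gcongr
        exact add_tsum_le_mul_stieltjes _ hF (spectralDensity_zero hA) hl
    _ = 2 * μ Ω * stieltjes (spectralDensity A) (spectralDensity_mono A) hF l := by
        have h1 : (2 : ℝ≥0∞) / l * l = 2 :=
          ENNReal.div_mul_cancel (by simpa using hl) ENNReal.coe_ne_top
        calc _ = (2 / l * l) * μ Ω *
              stieltjes (spectralDensity A) (spectralDensity_mono A) hF l := by ring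
          _ = _ := by rw [h1]
    _ ≤ _ := by
        gcongr
        exact stieltjes_le_stieltjesExt _ hF le_rfl

theorem tsum_dyadicForm_le (hA : IsPositiveSelfAdjoint A)
    (hF : ∀ l : ℝ≥0, spectralDensity A l ≠ ∞)
    (hΩ : MeasurableSet Ω) (hμΩ : μ Ω ≠ ∞) {l : ℝ≥0} (hl : l ≠ 0) :
    ∑' i, dyadicForm A l (indicatorOp μ H hΩ (basis (Lp H 2 μ) i)) ≤
      2 * μ Ω * stieltjesExt (spectralDensity A) (spectralDensity_mono A) hF l := by
  refine le_trans (le_of_eq ?_) (dyadic_hsSq_le hA hF hΩ hμΩ hl)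
  simp only [dyadicForm]
  rw [ENNReal.tsum_mul_left, ENNReal.tsum_add, ENNReal.tsum_comm]
  simp_rw [ENNReal.tsum_mul_left]
  rfl

theorem dyadicForm_indicatorOp_le (hA : IsPositiveSelfAdjoint A)
    (hF : ∀ l : ℝ≥0, spectralDensity A l ≠ ∞)
    (hΩ : MeasurableSet Ω) (hμΩ : μ Ω ≠ ∞) {l : ℝ≥0} (hl : l ≠ 0) (w : Lp H 2 μ) :
    dyadicForm A l (indicatorOp μ H hΩ w) ≤ ENNReal.ofReal (‖w‖ ^ 2) *
      (2 * μ Ω * stieltjesExt (spectralDensity A) (spectralDensity_mono A) hF l) := by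
  refine le_trans ?_ (mul_le_mul_right (dyadic_hsSq_le hA hF hΩ hμΩ hl) _)
  rw [mul_left_comm, mul_add, ← ENNReal.tsum_mul_left, dyadicForm]
  refine mul_le_mul_right (add_le_add
    (ofReal_norm_sq_apply_le_hsSq (spectralProj A l ∘L indicatorOp μ H hΩ) w)
    (ENNReal.tsum_le_tsum fun k => ?_)) _
  rw [mul_left_comm]
  exact mul_le_mul_right (ofReal_norm_sq_apply_le_hsSq
    (spectralProj A (l / 2 ^ (k + 1)) ∘L indicatorOp μ H hΩ) w) _

/-- For `s ≤ l` the squared norm of `Π_s χ_Ω w` is at most `‖w‖² μ(Ω) F(s) ≤ ‖w‖² μ(Ω) s G(l)`. This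
allows the dyadic truncation to be removed. -/
theorem tendsto_spectralProj_indicatorOp (hA : IsPositiveSelfAdjoint A)
    (hF : ∀ l : ℝ≥0, spectralDensity A l ≠ ∞) (l : ℝ≥0)
    (hG : stieltjesExt (spectralDensity A) (spectralDensity_mono A) hF l ≠ ∞)
    (hΩ : MeasurableSet Ω) (hμΩ : μ Ω ≠ ∞) (w : Lp H 2 μ) :
    Tendsto (fun N : ℕ => spectralProj A (l / 2 ^ N) (indicatorOp μ H hΩ w)) atTop (𝓝 0) := by
  set G := stieltjesExt (spectralDensity A) (spectralDensity_mono A) hF l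
  set c : ℝ≥0∞ := ENNReal.ofReal (‖w‖ ^ 2) * (μ Ω * G)
  have hc : c ≠ ∞ := ENNReal.mul_ne_top ENNReal.ofReal_ne_top (ENNReal.mul_ne_top hμΩ hG)
  have hbound : ∀ N : ℕ,
      ENNReal.ofReal (‖spectralProj A (l / 2 ^ N) (indicatorOp μ H hΩ w)‖ ^ 2) ≤
        ((l / 2 ^ N : ℝ≥0) : ℝ≥0∞) * c := by
    intro N
    have hle : l / 2 ^ N ≤ l := by simpa using dyadic_antitone l (Nat.zero_le N)
    calc _ ≤ ENNReal.ofReal (‖w‖ ^ 2) *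
          hsSq (spectralProj A (l / 2 ^ N) ∘L indicatorOp μ H hΩ) :=
          ofReal_norm_sq_apply_le_hsSq (spectralProj A (l / 2 ^ N) ∘L indicatorOp μ H hΩ) w
      _ ≤ ENNReal.ofReal (‖w‖ ^ 2) * (μ Ω * (((l / 2 ^ N : ℝ≥0) : ℝ≥0∞) * G)) := by
          gcongr
          refine (hsSq_spectralProj_indicatorOp_le hF hΩ hμΩ _).trans ?_
          gcongr
          refine (le_mul_stieltjes (spectralDensity_mono A) hF
            (spectralDensity_zero hA) _).trans ?_
          gcongr
          exact stieltjes_le_stieltjesExt _ hF (by exact_mod_cast hle)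
      _ = _ := by ring
  have hlim : Tendsto (fun N : ℕ => ((l / 2 ^ N : ℝ≥0) : ℝ≥0∞) * c) atTop (𝓝 0) := by
    have h1 : Tendsto (fun N : ℕ => l / 2 ^ N) atTop (𝓝 0) := by
      have h2 := (tendsto_pow_atTop_nhds_zero_of_lt_one (r := (2⁻¹ : ℝ≥0)) zero_le
        (by rw [← NNReal.coe_lt_coe]; push_cast; norm_num)).const_mul l
      rw [mul_zero] at h2
      simpa [div_eq_mul_inv] using h2
    have h3 := ENNReal.Tendsto.mul_const (ENNReal.tendsto_coe.mpr h1) (Or.inr hc)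
    simpa using h3
  have h4 := tendsto_of_tendsto_of_tendsto_of_le_of_le tendsto_const_nhds hlim
    (fun _ => zero_le) hbound
  have h5 := (ENNReal.tendsto_toReal ENNReal.zero_ne_top).comp h4
  simp only [Function.comp_def, ENNReal.toReal_zero] at h5
  rw [tendsto_zero_iff_norm_tendsto_zero]
  have h6 := h5.sqrt
  rw [Real.sqrt_zero] at h6
  refine h6.congr fun N => ?_
  rw [ENNReal.toReal_ofReal (by positivity), Real.sqrt_sq (norm_nonneg _)]

theorem sqrtOp_apply_mem_orthogonal_kernel {ρ : Lp H 2 μ →L[ℂ] Lp H 2 μ} (hρ : ρ.IsPositive)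
    (hker : ∀ f ∈ kernel A, ρ f = 0) (f : Lp H 2 μ) : sqrtOp ρ f ∈ (kernel A)ᗮ := by
  rw [Submodule.mem_orthogonal]
  intro u hu
  rw [← inner_sqrtOp_left, sqrtOp_apply_eq_zero hρ (hker u hu), inner_zero_left]

/-- From `χ_Ω ρ = ρ` comes `ρ (1 - χ_Ω) = 0`, hence `ρ^{1/2} (1 - χ_Ω) = 0`; then take adjoints. -/
theorem indicatorOp_sqrtOp_apply (hΩ : MeasurableSet Ω) {ρ : Lp H 2 μ →L[ℂ] Lp H 2 μ}
    (hρ : ρ.IsPositive) (hsupp : ∀ f, SupportedIn Ω (ρ f)) (f : Lp H 2 μ) :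
    indicatorOp μ H hΩ (sqrtOp ρ f) = sqrtOp ρ f := by
  have h1 : ∀ g, sqrtOp ρ (g - indicatorOp μ H hΩ g) = 0 := by
    intro g
    refine sqrtOp_apply_eq_zero hρ (ext_inner_right ℂ fun v => ?_)
    have hsym : ∀ x, ⟪ρ x, v⟫_ℂ = ⟪x, ρ v⟫_ℂ := fun x => hρ.isSelfAdjoint.isSymmetric x v
    rw [hsym, inner_sub_left, inner_indicatorOp,
      indicatorOp_apply_of_supportedIn hΩ (hsupp v), sub_self, inner_zero_left]
  refine ext_inner_right ℂ fun v => ?_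
  rw [inner_indicatorOp, inner_sqrtOp_left, inner_sqrtOp_left]
  have h2 := h1 v
  rw [map_sub, sub_eq_zero] at h2
  rw [h2]

/-- The adjoint `ρ^{1/2} Π_l χ_Ω` has the same Hilbert-Schmidt norm. Its columns are tested against
unit vectors `f`, so Cauchy-Schwarz only meets the energies `𝓔(ρ^{1/2} f)`. -/
theorem hsSq_indicatorOp_spectralProj_sqrtOp_le_stateNorm (hA : IsPositiveSelfAdjoint A)
    (hF : ∀ l : ℝ≥0, spectralDensity A l ≠ ∞) {l : ℝ≥0} (hl : l ≠ 0)
    (hG : stieltjesExt (spectralDensity A) (spectralDensity_mono A) hF l ≠ ∞)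
    (hΩ : MeasurableSet Ω) (hμΩ : μ Ω ≠ ∞) {ρ : Lp H 2 μ →L[ℂ] Lp H 2 μ} (hρ : ρ.IsPositive)
    (hker : ∀ f ∈ kernel A, ρ f = 0) :
    hsSq (indicatorOp μ H hΩ ∘L spectralProj A l ∘L sqrtOp ρ) ≤ stateNorm A ρ *
      (2 * μ Ω * stieltjesExt (spectralDensity A) (spectralDensity_mono A) hF l) := by
  refine le_trans ?_ (mul_le_mul_right (tsum_dyadicForm_le hA hF hΩ hμΩ hl) _)
  rw [← hsSq_adjoint, ← ENNReal.tsum_mul_left, hsSq, ContinuousLinearMap.adjoint_comp,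
    ContinuousLinearMap.adjoint_comp, adjoint_indicatorOp, adjoint_spectralProj,
    (isSelfAdjoint_sqrtOp ρ).adjoint_eq]
  refine ENNReal.tsum_le_tsum fun i => ?_
  set g := indicatorOp μ H hΩ (basis (Lp H 2 μ) i)
  change ENNReal.ofReal (‖sqrtOp ρ (spectralProj A l g)‖ ^ 2) ≤ _
  set v := sqrtOp ρ (spectralProj A l g) with hv
  rcases eq_or_ne v 0 with h0 | h0
  · simp [h0]
  -- The unit vector along `v` realises `‖v‖` as an inner product.
  set f : Lp H 2 μ := ((‖v‖⁻¹ : ℝ) : ℂ) • v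
  have hv0 : ‖v‖ ≠ 0 := norm_ne_zero_iff.mpr h0
  have hf : ‖f‖ ≤ 1 := by
    rw [norm_smul, Complex.norm_real, norm_inv, norm_norm, inv_mul_cancel₀ hv0]
  have h1 : ‖⟪sqrtOp ρ f, spectralProj A l g⟫_ℂ‖ = ‖v‖ := by
    rw [inner_sqrtOp_left, ← hv, inner_smul_left, inner_self_eq_norm_sq_to_K, Complex.conj_ofReal]
    rw [norm_mul, Complex.norm_real, norm_pow, norm_inv, norm_norm]
    have h2 : ‖((‖v‖ : ℝ) : ℂ)‖ = ‖v‖ := by simp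
    erw [h2]
    field_simp
  rw [← h1]
  refine (ofReal_norm_sq_inner_spectralProj_le hA hl
    (sqrtOp_apply_mem_orthogonal_kernel hρ hker f)
    (tendsto_spectralProj_indicatorOp hA hF l hG hΩ hμΩ _)).trans ?_
  gcongr
  exact energy_sqrtOp_le_stateNorm A ρ hf

/-- Duality with `w = χ_Ω Π_l h` itself: `‖w‖² = ⟨h, Π_l χ_Ω w⟩`, and one factor `‖w‖²` cancels
after Cauchy-Schwarz. -/
theorem ofReal_norm_sq_indicatorOp_spectralProj_le (hA : IsPositiveSelfAdjoint A)
    (hF : ∀ l : ℝ≥0, spectralDensity A l ≠ ∞) {l : ℝ≥0} (hl : l ≠ 0)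
    (hG : stieltjesExt (spectralDensity A) (spectralDensity_mono A) hF l ≠ ∞)
    (hΩ : MeasurableSet Ω) (hμΩ : μ Ω ≠ ∞) {h : Lp H 2 μ} (hh : h ∈ (kernel A)ᗮ) :
    ENNReal.ofReal (‖indicatorOp μ H hΩ (spectralProj A l h)‖ ^ 2) ≤ energy A h *
      (2 * μ Ω * stieltjesExt (spectralDensity A) (spectralDensity_mono A) hF l) := by
  set w := indicatorOp μ H hΩ (spectralProj A l h) with hw
  rcases eq_or_ne w 0 with h0 | h0
  · simp [h0]
  have h1 : ‖⟪h, spectralProj A l (indicatorOp μ H hΩ w)⟫_ℂ‖ = ‖w‖ ^ 2 := by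
    rw [← inner_spectralProj_left, ← inner_indicatorOp, ← hw, inner_self_eq_norm_sq_to_K]
    simp
  have h2 := (ofReal_norm_sq_inner_spectralProj_le hA hl hh
    (tendsto_spectralProj_indicatorOp hA hF l hG hΩ hμΩ w)).trans
    (mul_le_mul_right (dyadicForm_indicatorOp_le hA hF hΩ hμΩ hl w) _)
  rw [h1, sq (‖w‖ ^ 2), ENNReal.ofReal_mul (by positivity), mul_left_comm] at h2
  have h3 : 0 < ‖w‖ := norm_pos_iff.mpr h0
  exact (ENNReal.mul_le_mul_iff_right (ENNReal.ofReal_pos.mpr (by positivity)).ne'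
    ENNReal.ofReal_ne_top).mp h2

/-- A cruder bound than the one by `stateNorm`. It serves to show that finite energy forces finite
trace and zero energy forces zero trace. -/
theorem hsSq_indicatorOp_spectralProj_sqrtOp_le_stateEnergy (hA : IsPositiveSelfAdjoint A)
    (hF : ∀ l : ℝ≥0, spectralDensity A l ≠ ∞) {l : ℝ≥0} (hl : l ≠ 0)
    (hG : stieltjesExt (spectralDensity A) (spectralDensity_mono A) hF l ≠ ∞)
    (hΩ : MeasurableSet Ω) (hμΩ : μ Ω ≠ ∞) {ρ : Lp H 2 μ →L[ℂ] Lp H 2 μ} (hρ : ρ.IsPositive)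
    (hker : ∀ f ∈ kernel A, ρ f = 0) :
    hsSq (indicatorOp μ H hΩ ∘L spectralProj A l ∘L sqrtOp ρ) ≤ stateEnergy A ρ *
      (2 * μ Ω * stieltjesExt (spectralDensity A) (spectralDensity_mono A) hF l) := by
  rw [stateEnergy_eq_tsum, ← ENNReal.tsum_mul_right]
  exact ENNReal.tsum_le_tsum fun i => ofReal_norm_sq_indicatorOp_spectralProj_le hA hF hl hG hΩ hμΩ
    (sqrtOp_apply_mem_orthogonal_kernel hρ hker _)

/-- Splitting a state at the spectral level `l`. -/
theorem trace_le_add_stateEnergy_div (hA : IsPositiveSelfAdjoint A) {l : ℝ≥0} (hl : l ≠ 0)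
    (hΩ : MeasurableSet Ω) {ρ : Lp H 2 μ →L[ℂ] Lp H 2 μ} (hρ : ρ.IsPositive)
    (hker : ∀ f ∈ kernel A, ρ f = 0) (hsupp : ∀ f, SupportedIn Ω (ρ f)) :
    trace ρ ≤ 2 * hsSq (indicatorOp μ H hΩ ∘L spectralProj A l ∘L sqrtOp ρ) +
      2 * (stateEnergy A ρ / l) := by
  rw [trace_eq_hsSq_sqrtOp hρ, stateEnergy_eq_tsum, ENNReal.div_eq_inv_mul, hsSq, hsSq,
    ← ENNReal.tsum_mul_left, ← ENNReal.tsum_mul_left, ← ENNReal.tsum_mul_left, ← ENNReal.tsum_add]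
  refine ENNReal.tsum_le_tsum fun i => ?_
  set h := sqrtOp ρ (basis (Lp H 2 μ) i) with hh
  have h1 : indicatorOp μ H hΩ h = h := indicatorOp_sqrtOp_apply hΩ hρ hsupp _
  have h2 := mul_norm_sq_sub_spectralProj_le_energy hA l
    (sqrtOp_apply_mem_orthogonal_kernel hρ hker (basis (Lp H 2 μ) i))
  rw [← hh, mul_comm, ← ENNReal.le_div_iff_mul_le (Or.inl (by simpa using hl))
    (Or.inl ENNReal.coe_ne_top), ENNReal.div_eq_inv_mul] at h2
  change _ ≤ 2 * ENNReal.ofReal (‖indicatorOp μ H hΩ (spectralProj A l h)‖ ^ 2) + _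
  refine le_trans ?_ (add_le_add_right (mul_le_mul_right h2 2) _)
  -- The factors 2 come from `(a + b)² ≤ 2 a² + 2 b²`.
  have h3 : ‖h‖ ^ 2 ≤ 2 * ‖indicatorOp μ H hΩ (spectralProj A l h)‖ ^ 2 +
      2 * ‖h - spectralProj A l h‖ ^ 2 := by
    have h4 : ‖h‖ ≤ ‖indicatorOp μ H hΩ (spectralProj A l h)‖ + ‖h - spectralProj A l h‖ := by
      have h5 : h = indicatorOp μ H hΩ (spectralProj A l h) +
          indicatorOp μ H hΩ (h - spectralProj A l h) := by
        rw [map_sub, h1, add_sub_cancel]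
      calc ‖h‖ = _ := congrArg norm h5
        _ ≤ _ := norm_add_le _ _
        _ ≤ _ := add_le_add_right (norm_indicatorOp_apply_le hΩ _) _
    nlinarith [sq_nonneg (‖indicatorOp μ H hΩ (spectralProj A l h)‖ -
      ‖h - spectralProj A l h‖), norm_nonneg h]
  refine (ENNReal.ofReal_le_ofReal h3).trans (le_of_eq ?_)
  rw [ENNReal.ofReal_add (by positivity) (by positivity), ENNReal.ofReal_mul (by positivity),
    ENNReal.ofReal_mul (by positivity), ENNReal.ofReal_ofNat]

/-- Each finite partial sum of the trace is the limit, as `l → ∞`, of partial sums bounded by `B`.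
-/
theorem trace_le_of_forall_hsSq_le (hA : IsPositiveSelfAdjoint A) (hΩ : MeasurableSet Ω)
    {ρ : Lp H 2 μ →L[ℂ] Lp H 2 μ} (hρ : ρ.IsPositive)
    (hker : ∀ f ∈ kernel A, ρ f = 0) (hsupp : ∀ f, SupportedIn Ω (ρ f)) {B : ℝ≥0∞}
    (hB : ∀ l : ℝ≥0, l ≠ 0 →
      hsSq (indicatorOp μ H hΩ ∘L spectralProj A l ∘L sqrtOp ρ) ≤ B) : trace ρ ≤ B := by
  rw [trace_eq_hsSq_sqrtOp hρ, hsSq, ENNReal.tsum_eq_iSup_sum]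
  refine iSup_le fun t => ?_
  have h1 : Tendsto (fun l : ℝ≥0 => ∑ i ∈ t, ENNReal.ofReal
      (‖indicatorOp μ H hΩ (spectralProj A l (sqrtOp ρ (basis (Lp H 2 μ) i)))‖ ^ 2)) atTop
      (𝓝 (∑ i ∈ t, ENNReal.ofReal (‖sqrtOp ρ (basis (Lp H 2 μ) i)‖ ^ 2))) := by
    refine tendsto_finsetSum _ fun i _ => ENNReal.tendsto_ofReal (Tendsto.pow (Tendsto.norm ?_) 2)
    have h2 := ((indicatorOp μ H hΩ).continuous.tendsto _).comp
      (tendsto_spectralProj_atTop hA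
        (sqrtOp_apply_mem_orthogonal_kernel hρ hker (basis (Lp H 2 μ) i)))
    rwa [indicatorOp_sqrtOp_apply hΩ hρ hsupp] at h2
  refine le_of_tendsto h1 ?_
  filter_upwards [eventually_gt_atTop 0] with l hl
  exact (ENNReal.sum_le_tsum t).trans (hB l hl.ne')

theorem trace_le_mul_stieltjesExt (hA : IsPositiveSelfAdjoint A)
    (hF : ∀ l : ℝ≥0, spectralDensity A l ≠ ∞)
    (hG : ∀ l : ℝ≥0, stieltjesExt (spectralDensity A) (spectralDensity_mono A) hF l ≠ ∞)
    (hΩ : MeasurableSet Ω) (hμΩ : μ Ω ≠ ∞) {ρ : Lp H 2 μ →L[ℂ] Lp H 2 μ} (hρ : ρ.IsPositive)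
    (hker : ∀ f ∈ kernel A, ρ f = 0) (hsupp : ∀ f, SupportedIn Ω (ρ f))
    (hfin : trace ρ ≠ ∞ ∨ stateEnergy A ρ ≠ ∞) :
    trace ρ ≤ 8 * μ Ω * stateNorm A ρ *
      stieltjesExt (spectralDensity A) (spectralDensity_mono A) hF (8 * expectation A ρ) := by
  set G := stieltjesExt (spectralDensity A) (spectralDensity_mono A) hF
  by_cases hE : stateEnergy A ρ = ∞
  · have hτ : trace ρ ≠ ∞ := hfin.resolve_right fun h => h hE
    have hexp : 8 * expectation A ρ = ∞ := by
      rw [expectation, hE, ENNReal.top_div_of_ne_top hτ, ENNReal.mul_top (by norm_num)]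
    rw [hexp]
    refine (trace_le_of_forall_hsSq_le hA hΩ hρ hker hsupp
      (B := stateNorm A ρ * (2 * μ Ω * G ∞)) fun l hl => ?_).trans ?_
    · refine (hsSq_indicatorOp_spectralProj_sqrtOp_le_stateNorm hA hF hl (hG l) hΩ hμΩ hρ
        hker).trans ?_
      gcongr
      exact stieltjesExt_mono _ hF le_top
    · calc stateNorm A ρ * (2 * μ Ω * G ∞) = 2 * μ Ω * stateNorm A ρ * G ∞ := by ring
        _ ≤ 8 * μ Ω * stateNorm A ρ * G ∞ := by
          gcongr
          norm_num
  -- The level `1` is arbitrary: this gives `τ(ρ) ≤ C 𝓔(ρ)` with `C` finite, which settles the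
  -- degenerate cases.
  have hone := (trace_le_add_stateEnergy_div hA one_ne_zero hΩ hρ hker hsupp).trans
    (add_le_add_left (mul_le_mul_right
      (hsSq_indicatorOp_spectralProj_sqrtOp_le_stateEnergy hA hF one_ne_zero (hG 1) hΩ hμΩ hρ hker)
      2) _)
  have hτ : trace ρ ≠ ∞ := by
    refine ne_top_of_le_ne_top ?_ hone
    have h1 := hG 1
    finiteness
  by_cases hτ0 : trace ρ = 0
  · rw [hτ0]; exact zero_le
  by_cases hE0 : stateEnergy A ρ = 0
  · rw [hE0] at hone
    simp only [zero_mul, mul_zero, ENNReal.zero_div, add_zero, nonpos_iff_eq_zero] at hone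
    exact absurd hone hτ0
  have hl_top : 8 * expectation A ρ ≠ ∞ :=
    ENNReal.mul_ne_top (by norm_num) (ENNReal.div_ne_top hE hτ0)
  obtain ⟨l, hl⟩ := WithTop.ne_top_iff_exists.mp hl_top
  change (l : ℝ≥0∞) = _ at hl
  have hl0 : l ≠ 0 := by
    rintro rfl
    rw [ENNReal.coe_zero, eq_comm, mul_eq_zero, expectation, ENNReal.div_eq_zero_iff] at hl
    rcases hl with h | h | h
    · norm_num at h
    · exact hE0 h
    · exact hτ h
  -- The chosen level makes the high frequency term `2 𝓔(ρ) / l` equal to `τ(ρ) / 4`.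
  have hEl : 8 * (stateEnergy A ρ / l) = trace ρ := by
    rw [hl, expectation, ← mul_div_assoc, ENNReal.mul_div_mul_left _ _ (by norm_num) (by norm_num)]
    rw [ENNReal.div_div_cancel hE0 hE]
  have hmain := (trace_le_add_stateEnergy_div hA hl0 hΩ hρ hker hsupp).trans
    (add_le_add_left (mul_le_mul_right
      (hsSq_indicatorOp_spectralProj_sqrtOp_le_stateNorm hA hF hl0 (hG l) hΩ hμΩ hρ hker) 2) _)
  rw [← hl]
  set Y := stateNorm A ρ * (2 * μ Ω * G l) with hY
  have hgoal : 8 * μ Ω * stateNorm A ρ * G l = 4 * Y := by rw [hY]; ring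
  rw [hgoal]
  by_cases hYtop : Y = ∞
  · rw [hYtop, ENNReal.mul_top (by norm_num)]; exact le_top
  set e := stateEnergy A ρ / l
  have hetop : e ≠ ∞ := ENNReal.div_ne_top hE (by simpa using hl0)
  rw [← hEl] at hmain ⊢
  clear_value Y e
  lift Y to ℝ≥0 using hYtop
  lift e to ℝ≥0 using hetop
  norm_cast at hmain ⊢
  rw [← NNReal.coe_le_coe] at hmain ⊢
  push_cast at hmain ⊢
  -- With `τ(ρ) = 8 e`, the splitting reads `8 e ≤ 2 Y + 2 e`, which gives more than the required `8
  -- e ≤ 4 Y`.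
  linarith [e.coe_nonneg]

end Bounds

/-! ### Dimension counting by projections -/

section Dimension

variable {X : Type*} [MeasurableSpace X] {μ : Measure X}
  {H : Type*} [NormedAddCommGroup H] [InnerProductSpace ℂ H] [CompleteSpace H]
  {A : Lp H 2 μ →ₗ.[ℂ] Lp H 2 μ} {Ω : Set X}

theorem finrank_le_mul_stieltjesExt (hA : IsPositiveSelfAdjoint A)
    (hF : ∀ l : ℝ≥0, spectralDensity A l ≠ ∞)
    (hG : ∀ l : ℝ≥0, stieltjesExt (spectralDensity A) (spectralDensity_mono A) hF l ≠ ∞)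
    (hΩ : MeasurableSet Ω) (hμΩ : μ Ω ≠ ∞) (l : ℝ≥0) (W : Submodule ℂ (Lp H 2 μ))
    [FiniteDimensional ℂ W] (hker : W ≤ (kernel A)ᗮ) (hsupp : ∀ f ∈ W, SupportedIn Ω f)
    (hen : ∀ f ∈ W, energy A f ≤ l * ENNReal.ofReal (‖f‖ ^ 2)) :
    (Module.finrank ℂ W : ℝ≥0∞) ≤ 8 * μ Ω * l *
      stieltjesExt (spectralDensity A) (spectralDensity_mono A) hF (8 * l) := by
  set P := W.starProjection
  have hP : P.IsPositive :=
    ContinuousLinearMap.IsPositive.of_isStarProjection isStarProjection_starProjection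
  have hsqrt : sqrtOp P = P := sqrtOp_starProjection W
  have hmem : ∀ f, P f ∈ W := Submodule.starProjection_apply_mem W
  have htr : trace P = (Module.finrank ℂ W : ℝ≥0∞) := trace_starProjection W
  have htop : trace P ≠ ∞ := by rw [htr]; exact ENNReal.natCast_ne_top _
  have hE : stateEnergy A P ≤ l * trace P := by
    rw [trace_eq_hsSq_sqrtOp hP, stateEnergy_eq_tsum, hsSq, hsqrt, ← ENNReal.tsum_mul_left]
    exact ENNReal.tsum_le_tsum fun i => hen _ (hmem _)
  have hK : stateNorm A P ≤ l := by
    refine stateNorm_le fun f hf => ?_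
    rw [hsqrt]
    refine (hen _ (hmem f)).trans (mul_le_of_le_one_right' ?_)
    rw [← ENNReal.ofReal_one]
    refine ENNReal.ofReal_le_ofReal (pow_le_one₀ (norm_nonneg _) ?_)
    exact (Submodule.norm_starProjection_apply_le W f).trans hf
  have hexp : expectation A P ≤ l := ENNReal.div_le_of_le_mul hE
  have hkerP : ∀ f ∈ kernel A, P f = 0 := fun f hf =>
    (Submodule.starProjection_apply_eq_zero_iff W).mpr
      ((Submodule.mem_orthogonal' _ _).mpr fun w hw =>
        (Submodule.mem_orthogonal _ _).mp (hker hw) f hf)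
  rw [← htr]
  refine (trace_le_mul_stieltjesExt hA hF hG hΩ hμΩ hP hkerP (fun f => hsupp _ (hmem f))
    (Or.inl htop)).trans ?_
  gcongr
  exact stieltjesExt_mono _ hF (by gcongr)

theorem dimCount_le_mul_stieltjesExt (hA : IsPositiveSelfAdjoint A)
    (hF : ∀ l : ℝ≥0, spectralDensity A l ≠ ∞)
    (hG : ∀ l : ℝ≥0, stieltjesExt (spectralDensity A) (spectralDensity_mono A) hF l ≠ ∞)
    (hΩ : MeasurableSet Ω) (hμΩ : μ Ω ≠ ∞) (l : ℝ≥0) :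
    dimCount A Ω l ≤ 8 * μ Ω * l *
      stieltjesExt (spectralDensity A) (spectralDensity_mono A) hF (8 * l) := by
  refine iSup_le fun V => iSup_le fun hker => iSup_le fun hsupp => iSup_le fun hen => ?_
  set B := 8 * μ Ω * l *
    stieltjesExt (spectralDensity A) (spectralDensity_mono A) hF (8 * l)
  -- The rank of `V` may be infinite, so the bound is applied to `n`-dimensional subspaces of `V`
  -- for every finite `n` up to the rank.
  have hn : ∀ n : ℕ, (n : ℕ∞) ≤ Cardinal.toENat (Module.rank ℂ V) → (n : ℝ≥0∞) ≤ B := by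
    intro n hn
    rw [Cardinal.natCast_le_toENat, Module.le_rank_iff_exists_linearMap] at hn
    obtain ⟨φ, hφ⟩ := hn
    set ψ := V.subtype ∘ₗ φ
    have hψ : Function.Injective ψ := V.injective_subtype.comp hφ
    have hW : LinearMap.range ψ ≤ V := by
      rintro _ ⟨x, rfl⟩
      exact (φ x).2
    have h := finrank_le_mul_stieltjesExt hA hF hG hΩ hμΩ l (LinearMap.range ψ)
      (hW.trans hker) (fun f hf => hsupp f (hW hf)) (fun f hf => hen f (hW hf))
    rwa [LinearMap.finrank_range_of_inj hψ, Module.finrank_fin_fun] at h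
  generalize Cardinal.toENat (Module.rank ℂ V) = d at hn
  induction d using ENat.recTopCoe with
  | top =>
    refine le_of_eq (ENNReal.eq_top_of_forall_nnreal_le fun r => ?_).symm |>.trans' le_top
    obtain ⟨n, hr⟩ := exists_nat_ge r
    exact le_trans (by exact_mod_cast hr) (hn n le_top)
  | coe n => simpa using hn n le_rfl

end Dimension

end MixedState

theorem mainTheorem12 {X : Type*} [MeasurableSpace X] (μ : Measure X)
    {H : Type*} [NormedAddCommGroup H] [InnerProductSpace ℂ H] [CompleteSpace H]
    (A : Lp H 2 μ →ₗ.[ℂ] Lp H 2 μ) (hA : MixedState.IsPositiveSelfAdjoint A)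
    (hF : ∀ l : ℝ≥0, MixedState.spectralDensity A l ≠ ∞)
    (G : ℝ≥0∞ → ℝ≥0∞)
    (hGdef : G = MixedState.stieltjesExt (MixedState.spectralDensity A)
      (MixedState.spectralDensity_mono A) hF)
    (hG : ∀ l : ℝ≥0, G l ≠ ∞)
    (Ω : Set X) (hΩ : MeasurableSet Ω) (hμΩ : μ Ω ≠ ∞) :
    (∀ ρ : Lp H 2 μ →L[ℂ] Lp H 2 μ, ρ.IsPositive →
      (∀ f ∈ MixedState.kernel A, ρ f = 0) →
      (∀ f : Lp H 2 μ, MixedState.SupportedIn Ω (ρ f)) →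
      (MixedState.trace ρ ≠ ∞ ∨ MixedState.stateEnergy A ρ ≠ ∞) →
      MixedState.trace ρ ≤
        8 * μ Ω * MixedState.stateNorm A ρ * G (8 * MixedState.expectation A ρ)) ∧
    (∀ l : ℝ≥0, MixedState.dimCount A Ω l ≤ 8 * μ Ω * l * G (8 * l)) ∧
    (∀ l : ℝ≥0, MixedState.spectralDensity A l ≤ l * G l) := by
  subst hGdef
  refine ⟨fun ρ hρ hker hsupp hfin =>
      MixedState.trace_le_mul_stieltjesExt hA hF hG hΩ hμΩ hρ hker hsupp hfin,
    MixedState.dimCount_le_mul_stieltjesExt hA hF hG hΩ hμΩ, fun l => ?_⟩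
  refine (MixedState.le_mul_stieltjes (MixedState.spectralDensity_mono A) hF
    (MixedState.spectralDensity_zero hA) l).trans ?_
  gcongr
  exact MixedState.stieltjes_le_stieltjesExt _ hF le_rfl
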